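/- **Setting.** Let $W\in\mathbb R^{n\times n}$ be the symmetric, entrywise nonnegative weighted adjacency matrix of an undirected graph on $n$ vertices, $D$ its diagonal degree matrix, and $L=I-D^{-1/2}WD^{-1/2}$ the normalized Laplacian (with the convention that the entry of $D^{-1/2}$ at a vertex of degree $0$ is $0$). Let $L=U\,\mathrm{diag}(\sigma_1,\dots,\sigma_n)\,U^\top$ with $U=(u_1,\dots,u_n)$ orthogonal and $\sigma_1\le\dots\le\sigma_n$. Fix $\Delta t>0$ and put $A=\exp(-\Delta t\,L)$, $\lambda_i=e^{-\Delta t\,\sigma_i}$. Fix integers $1\le k<n$ and $T\ge 1$; put $U_k=(u_1,\dots,u_k)$, $\pi_{A,T}(x)=(x,Ax,\dots,A^{T-1}x)\in\mathbb R^{Tn}$, $f_T(\lambda)=\big(\sum_{t=0}^{T-1}\lambda^{2t}\big)^{1/2}$. The coordinates of $\mathbb R^{Tn}$ are indexed by pairs $(t,i)$, $0\le t\le T-1$, $1\le i\le n$. Let $\widetilde U$ be the $Tn\times k$ matrix with entries $\widetilde U_{(t,i),l}=\lambda_l^t\,u_l(i)/f_T(\lambda_l)$, let $\widetilde U_{(\cdot,i)}$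 be its $T\times k$ submatrix formed by the rows $(0,i),\dots,(T-1,i)$, and let $\delta_{(t,i)}$ be the standard basis vectors of $\mathbb R^{Tn}$. Norms $\|\cdot\|_2$ are Euclidean norms of vectors and operator (spectral) norms of matrices. **Sampling regimes.** All probability distributions below have only positive weights, and all draws are independent and with replacement. In each regime $S$ is the $0$-$1$ matrix whose rows pick out the sampled coordinates of $\mathbb R^{Tn}$, and $P_\Omega=\mathrm{diag}(SPS^\top)$ is the diagonal part of $SPS^\top$. 1. $p$ is a distribution on $[n]$; $m$ vertices are drawn from $p$ and each is observed at all times $t=0,\dots,T-1$. $P=\mathrm{diag}(p;\dots;p)$ ($T$ blocks), $\mathcal W=\frac1m I_{mT}$, and $\nu=\max_i p(i)^{-1/2}\|\widetilde U_{(\cdot,i)}\|_2$. 2. $p_0,\dots,p_{T-1}$ are distributions on $[n]$; for every $t$, $m_t$ vertices are drawn from $p_t$ and observed at time $t$. $P=\mathrm{diag}(p_0;\dots;p_{T-1})$, $\mathcal W=\mathrm{diag}(\frac1{m_0}I_{m_0};\dots;\frac1{m_{T-1}}I_{m_{T-1}})$, and $\nu(t)=\max_i p_t(i)^{-1/2}\|\widetilde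 U^\top\delta_{(t,i)}\|_2$. 3. $p$ is a distribution on the $Tn$ space-time nodes; $m$ nodes are drawn from $p$ and observed. $P=\mathrm{diag}(p)$, $\mathcal W=\frac1m I_m$, and $\nu=\max_{(t,i)}p(t,i)^{-1/2}\|\widetilde U^\top\delta_{(t,i)}\|_2$. **Theorem.** Let $\varepsilon,\delta\in(0,1)$. In regimes 1 and 3 suppose $m\ge\frac3{\delta^2}\nu^2\log\frac{2k}{\varepsilon}$; in regime 2 suppose $m_t\ge\frac3{\delta^2}\nu(t)^2\log\frac{2k}{\varepsilon}$ for every $t$. Then, in each of the three regimes, with probability at least $1-\varepsilon$ over the draws, the following holds simultaneously for all $x\in\mathrm{span}(U_k)$, all noise vectors $e$, all $\gamma>0$, all real polynomials $g$ that are nonnegative and nondecreasing on the spectrum of $L$ (in particular all those that are nonnegative and nondecreasing on $[0,\infty)$) with $g(\sigma_{k+1})>0$, and all $M_{\max}>0$ with $\|P_\Omega^{-1/2}\mathcal W^{1/2}S\|_2\le M_{\max}$. Put $y=S\,\pi_{A,T}(x)+e$. The problem $$\min_{\tilde x\in\mathbb R^n}\ \big\|P_\Omega^{-1/2}\mathcal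 W^{1/2}\big(S\,\pi_{A,T}(\tilde x)-y\big)\big\|_2^2+\gamma\,\tilde x^\top g(L)\,\tilde x$$ has exactly one solution $x^*$, and $\alpha^*=U_kU_k^\top x^*$, $\beta^*=(I_n-U_kU_k^\top)x^*$ satisfy $$\begin{aligned}\|\alpha^*-x\|_2\le{}&\frac1{\sqrt{1-\delta}\,f_T(\lambda_k)}\Big(2+\frac{M_{\max}f_T(\lambda_{k+1})}{\sqrt{\gamma g(\sigma_{k+1})}}\Big)\|P_\Omega^{-1/2}\mathcal W^{1/2}e\|_2\\&+\frac1{\sqrt{1-\delta}\,f_T(\lambda_k)}\Big(M_{\max}f_T(\lambda_{k+1})\sqrt{\tfrac{g(\sigma_k)}{g(\sigma_{k+1})}}+\sqrt{\gamma g(\sigma_k)}\Big)\|x\|_2,\end{aligned}$$ $$\|\beta^*\|_2\le\frac1{\sqrt{\gamma g(\sigma_{k+1})}}\|P_\Omega^{-1/2}\mathcal W^{1/2}e\|_2+\sqrt{\tfrac{g(\sigma_k)}{g(\sigma_{k+1})}}\,\|x\|_2 .$$ In particular, if $g(\sigma_k)=0$ and $e=0$, then $x^*=x$. -/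

import Mathlib

open Matrix MeasureTheory ProbabilityTheory

noncomputable section

namespace GraphSampling

section Graph

variable {n : ℕ}

/-- A weighted adjacency matrix of an undirected graph: symmetric with nonnegative entries. -/
structure IsWeightMatrix (W : Matrix (Fin n) (Fin n) ℝ) : Prop where
  symm : W.IsSymm
  nonneg : ∀ i j, 0 ≤ W i j

/-- The degree `deg(v_i) = ∑ j, W(i,j)`. -/
def degree (W : Matrix (Fin n) (Fin n) ℝ) (i : Fin n) : ℝ := ∑ j, W i j

/-- `D^{-1/2}`, where `D` is the diagonal degree matrix (with the usual convention that the entry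
of a vertex of degree zero is `0`). -/
def degreeInvSqrt (W : Matrix (Fin n) (Fin n) ℝ) : Matrix (Fin n) (Fin n) ℝ :=
  diagonal fun i => degree W i ^ (-(1 / 2) : ℝ)

/-- The normalized graph Laplacian `L = I - D^{-1/2} W D^{-1/2}`. -/
def laplacian (W : Matrix (Fin n) (Fin n) ℝ) : Matrix (Fin n) (Fin n) ℝ :=
  1 - degreeInvSqrt W * W * degreeInvSqrt W

/-- The evolution operator `A = exp(-Δt L)`. -/
def evolution (W : Matrix (Fin n) (Fin n) ℝ) (dt : ℝ) : Matrix (Fin n) (Fin n) ℝ :=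
  NormedSpace.exp ((-dt) • laplacian W)

/-- `L = U Σ Uᵀ` is an eigendecomposition of the graph Laplacian: `U` is orthogonal and the
eigenvalues on the diagonal of `Σ` are in nondecreasing order. -/
structure IsEigendecomposition (W U : Matrix (Fin n) (Fin n) ℝ) (σ : Fin n → ℝ) : Prop where
  orthogonal : U ∈ Matrix.orthogonalGroup (Fin n) ℝ
  mono : Monotone σ
  eq : laplacian W = U * diagonal σ * Uᵀ

/-- `U_k`, the first `k` columns of `U`. -/
def firstCols (U : Matrix (Fin n) (Fin n) ℝ) {k : ℕ} (hk : k < n) : Matrix (Fin n) (Fin k) ℝ :=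
  U.submatrix id (Fin.castLE hk.le)

/-- `span(U_k)`, the space of `k`-bandlimited signals. -/
def bandlimited (U : Matrix (Fin n) (Fin n) ℝ) {k : ℕ} (hk : k < n) :
    Submodule ℝ (EuclideanSpace ℝ (Fin n)) :=
  Submodule.span ℝ (Set.range fun l : Fin k => WithLp.toLp 2 fun i => firstCols U hk i l)

/-- The matrix of `π_{A,T} : x ↦ (x, A x, …, A^{T-1} x)`. The coordinates of `ℝ^{Tn}` are indexed
by pairs `(t, i)`, i.e. by the time instance `t = 0, …, T-1` and the vertex `i`. -/
def spaceTimeMap (A : Matrix (Fin n) (Fin n) ℝ) (T : ℕ) : Matrix (Fin T × Fin n) (Fin n) ℝ :=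
  Matrix.of fun r j => (A ^ (r.1 : ℕ)) r.2 j

/-- `f_T(λ) = √(∑_{t=0}^{T-1} λ^{2t})`. -/
def fT (T : ℕ) (l : ℝ) : ℝ := √(∑ t ∈ Finset.range T, l ^ (2 * t))

/-- `λ_i = exp(-Δt σ_i)`. -/
def evolutionEigenvalue (σ : Fin n → ℝ) (dt : ℝ) (i : Fin n) : ℝ := Real.exp (-dt * σ i)

/-- The `Tn × k` matrix `Ũ_{k,T}`, whose `((t,i), l)` entry is `λ_l^t / f_T(λ_l) * u_l(i)`. -/
def spaceTimeModes (U : Matrix (Fin n) (Fin n) ℝ) (σ : Fin n → ℝ) (dt : ℝ) {k : ℕ} (hk : k < n)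
    (T : ℕ) : Matrix (Fin T × Fin n) (Fin k) ℝ :=
  Matrix.of fun r l =>
    evolutionEigenvalue σ dt (Fin.castLE hk.le l) ^ (r.1 : ℕ) /
      fT T (evolutionEigenvalue σ dt (Fin.castLE hk.le l)) * firstCols U hk r.2 l

end Graph

section Matrices

variable {ι κ : Type*} [Fintype ι] [Fintype κ] [DecidableEq ι] [DecidableEq κ]

/-- The `ℓ²` operator norm of a rectangular real matrix. -/
def specNorm (B : Matrix ι κ ℝ) : ℝ := ‖LinearMap.toContinuousLinearMap (Matrix.toEuclideanLin B)‖

/-- The real power `B^s` of a diagonal matrix with positive diagonal entries. -/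
def diagPow (B : Matrix ι ι ℝ) (s : ℝ) : Matrix ι ι ℝ := diagonal fun i => B i i ^ s

/-- The `0`-`1` matrix whose row `r` picks out the coordinate `loc r`. -/
def samplingMatrix (loc : ι → κ) : Matrix ι κ ℝ := Matrix.of fun r c => if c = loc r then 1 else 0

/-- The probability matrix on the sampling set, `P_Ω = diag(S P Sᵀ)` (the diagonal part). -/
def sampledProb (S : Matrix ι κ ℝ) (P : Matrix κ κ ℝ) : Matrix ι ι ℝ :=
  diagonal (S * P * Sᵀ).diag

/-- The matrix `P_Ω^{-1/2} W^{1/2}`. -/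
def reweighting (S : Matrix ι κ ℝ) (P : Matrix κ κ ℝ) (Wt : Matrix ι ι ℝ) : Matrix ι ι ℝ :=
  diagPow (sampledProb S P) (-(1 / 2)) * diagPow Wt (1 / 2)

end Matrices

section Coherence

variable {n : ℕ}

/-- Coherence of the first regime,
`max_i p(i)^{-1/2} ‖Ũ_{k,T}((i:n:Tn),:)‖₂`: the norm is that of the `T × k` matrix formed by the
rows of `Ũ_{k,T}` that belong to vertex `i`. -/
def coherence1 {T k : ℕ} (V : Matrix (Fin T × Fin n) (Fin k) ℝ) (p : Fin n → ℝ) : ℝ :=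
  ⨆ i : Fin n, 1 / √(p i) * specNorm (V.submatrix (fun t : Fin T => (t, i)) id)

/-- Coherence of the second regime at time `t`, `max_i p_t(i)^{-1/2} ‖Ũ_{k,T}ᵀ δ_{(t,i)}‖₂`. -/
def coherence2 {T k : ℕ} (V : Matrix (Fin T × Fin n) (Fin k) ℝ) (p : Fin T → Fin n → ℝ)
    (t : Fin T) : ℝ :=
  ⨆ i : Fin n, 1 / √(p t i) *
    ‖Matrix.toEuclideanLin Vᵀ (EuclideanSpace.single (t, i) (1 : ℝ))‖

/-- Coherence of the third regime, `max_{(t,i)} p(t,i)^{-1/2} ‖Ũ_{k,T}ᵀ δ_{(t,i)}‖₂`. -/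
def coherence3 {T k : ℕ} (V : Matrix (Fin T × Fin n) (Fin k) ℝ) (p : Fin T × Fin n → ℝ) : ℝ :=
  ⨆ r : Fin T × Fin n, 1 / √(p r) *
    ‖Matrix.toEuclideanLin Vᵀ (EuclideanSpace.single r (1 : ℝ))‖

end Coherence

section Sampling

/-- A non-degenerate (entrywise nonzero) probability distribution on a finite set. -/
structure IsNondegenerate {κ : Type*} [Fintype κ] (p : κ → ℝ) : Prop where
  pos : ∀ c, 0 < p c
  sum_one : ∑ c, p c = 1

/-- The random indices `ω j` are drawn independently, the `j`-th one according to `q j`. -/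
structure IsIndependentDraw {ι κ Ω : Type*} [MeasurableSpace κ] [MeasurableSpace Ω]
    (μ : Measure Ω) (q : ι → κ → ℝ) (ω : ι → Ω → κ) : Prop where
  measurable : ∀ j, Measurable (ω j)
  indep : iIndepFun ω μ
  law : ∀ j c, μ.real {s | ω j s = c} = q j c

variable {n T : ℕ}

/-- `S₁ = diag(S₁⁽⁰⁾; …; S₁⁽⁰⁾)` (`T` blocks): the drawn vertices are observed at all times. -/
def S1 (T : ℕ) {m : ℕ} (v : Fin m → Fin n) : Matrix (Fin T × Fin m) (Fin T × Fin n) ℝ :=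
  samplingMatrix fun r => (r.1, v r.2)

/-- `P₁ = diag(p; …; p)`. -/
def P1 (T : ℕ) (p : Fin n → ℝ) : Matrix (Fin T × Fin n) (Fin T × Fin n) ℝ :=
  diagonal fun r => p r.2

/-- `W₁ = (1/m) I`. -/
def W1 (T m : ℕ) : Matrix (Fin T × Fin m) (Fin T × Fin m) ℝ := (1 / (m : ℝ)) • 1

/-- `S₂ = diag(S₂⁽⁰⁾; …; S₂⁽ᵀ⁻¹⁾)`: at each time `t`, the `m t` vertices drawn for that time are
observed. -/
def S2 {m : Fin T → ℕ} (v : (t : Fin T) × Fin (m t) → Fin n) :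
    Matrix ((t : Fin T) × Fin (m t)) (Fin T × Fin n) ℝ :=
  samplingMatrix fun r => (r.1, v r)

/-- `P₂ = diag(p_0; …; p_{T-1})`. -/
def P2 (p : Fin T → Fin n → ℝ) : Matrix (Fin T × Fin n) (Fin T × Fin n) ℝ :=
  diagonal fun r => p r.1 r.2

/-- `W₂ = diag((1/m_0) I; …; (1/m_{T-1}) I)`. -/
def W2 (m : Fin T → ℕ) : Matrix ((t : Fin T) × Fin (m t)) ((t : Fin T) × Fin (m t)) ℝ :=
  diagonal fun r => 1 / (m r.1 : ℝ)

/-- `S₃`: the drawn space-time nodes are observed. -/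
def S3 {m : ℕ} (v : Fin m → Fin T × Fin n) : Matrix (Fin m) (Fin T × Fin n) ℝ :=
  samplingMatrix v

/-- `P₃ = diag(p)`. -/
def P3 (p : Fin T × Fin n → ℝ) : Matrix (Fin T × Fin n) (Fin T × Fin n) ℝ := diagonal p

/-- `W₃ = (1/m) I`. -/
def W3 (m : ℕ) : Matrix (Fin m) (Fin m) ℝ := (1 / (m : ℝ)) • 1

end Sampling

section Reconstruction

variable {n T : ℕ} {ι : Type*} [Fintype ι] [DecidableEq ι]

/-- The objective
`‖P_Ω^{-1/2} W^{1/2} (S π_{A,T}(z) - y)‖₂² + γ zᵀ g(L) z`, with `R = P_Ω^{-1/2} W^{1/2}`. -/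
def objective (L A : Matrix (Fin n) (Fin n) ℝ) (S : Matrix ι (Fin T × Fin n) ℝ)
    (R : Matrix ι ι ℝ) (γ : ℝ) (g : Polynomial ℝ) (y : EuclideanSpace ℝ ι)
    (z : EuclideanSpace ℝ (Fin n)) : ℝ :=
  ‖Matrix.toEuclideanLin R (Matrix.toEuclideanLin (S * spaceTimeMap A T) z - y)‖ ^ 2 +
    γ * inner ℝ z (Matrix.toEuclideanLin (Polynomial.aeval L g) z)

/-- `xs` minimizes the objective over `ℝⁿ`. -/
def IsSolution (L A : Matrix (Fin n) (Fin n) ℝ) (S : Matrix ι (Fin T × Fin n) ℝ)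
    (R : Matrix ι ι ℝ) (γ : ℝ) (g : Polynomial ℝ) (y : EuclideanSpace ℝ ι)
    (xs : EuclideanSpace ℝ (Fin n)) : Prop :=
  ∀ z, objective L A S R γ g y xs ≤ objective L A S R γ g y z

/-- `α* = U_k U_kᵀ x*`. -/
def inBand (U : Matrix (Fin n) (Fin n) ℝ) {k : ℕ} (hk : k < n) (xs : EuclideanSpace ℝ (Fin n)) :
    EuclideanSpace ℝ (Fin n) :=
  Matrix.toEuclideanLin (firstCols U hk * (firstCols U hk)ᵀ) xs

/-- `β* = (I - U_k U_kᵀ) x*`. -/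
def outOfBand (U : Matrix (Fin n) (Fin n) ℝ) {k : ℕ} (hk : k < n)
    (xs : EuclideanSpace ℝ (Fin n)) : EuclideanSpace ℝ (Fin n) :=
  Matrix.toEuclideanLin (1 - firstCols U hk * (firstCols U hk)ᵀ) xs

/-- The bound on `‖α* - x‖₂`; here `noise = ‖P_Ω^{-1/2} W^{1/2} e‖₂` and `signal = ‖x‖₂`, `fk, fk1`
are `f_T(λ_k), f_T(λ_{k+1})` and `gk, gk1` are `g(σ_k), g(σ_{k+1})`. -/
def inBandBound (δ γ Mmax fk fk1 gk gk1 noise signal : ℝ) : ℝ :=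
  1 / (√(1 - δ) * fk) * (2 + Mmax * fk1 / √(γ * gk1)) * noise +
    1 / (√(1 - δ) * fk) * (Mmax * fk1 * √(gk / gk1) + √(γ * gk)) * signal

/-- The bound on `‖β*‖₂`. -/
def outOfBandBound (γ gk gk1 noise signal : ℝ) : ℝ :=
  1 / √(γ * gk1) * noise + √(gk / gk1) * signal

/-- For the given sampling, probability and weighting matrices, the reconstruction guarantee holds
simultaneously for all signals `x ∈ span(U_k)`, all noise vectors `e`, all `γ > 0`, all polynomials
`g` that are nonnegative and nondecreasing on the spectrum of `L` with `g(σ_{k+1}) > 0`, and all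
bounds `Mmax` on `‖P_Ω^{-1/2} W^{1/2} S‖₂`. As `σ` is indexed from `0`, `σ_k` and `σ_{k+1}` are its
values at the indices `k - 1` and `k`. -/
def ReconstructionGuarantee (Wadj U : Matrix (Fin n) (Fin n) ℝ) (σ : Fin n → ℝ) (dt : ℝ) {k : ℕ}
    (hk : k < n) (δ : ℝ) (S : Matrix ι (Fin T × Fin n) ℝ)
    (P : Matrix (Fin T × Fin n) (Fin T × Fin n) ℝ) (Wt : Matrix ι ι ℝ) : Prop :=
  let L := laplacian Wadj
  let A := evolution Wadj dt
  let R := reweighting S P Wt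
  let σk := σ ⟨k - 1, by omega⟩
  let σk1 := σ ⟨k, hk⟩
  let fk := fT T (evolutionEigenvalue σ dt ⟨k - 1, by omega⟩)
  let fk1 := fT T (evolutionEigenvalue σ dt ⟨k, hk⟩)
  ∀ x ∈ bandlimited U hk, ∀ e : EuclideanSpace ℝ ι, ∀ γ : ℝ, 0 < γ → ∀ g : Polynomial ℝ,
    (∀ s ∈ spectrum ℝ L, 0 ≤ g.eval s) →
    MonotoneOn (fun s => g.eval s) (spectrum ℝ L) →
    0 < g.eval σk1 →
    ∀ Mmax : ℝ, 0 < Mmax → specNorm (R * S) ≤ Mmax →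
    (∃! xs, IsSolution L A S R γ g
      (Matrix.toEuclideanLin (S * spaceTimeMap A T) x + e) xs) ∧
    ∀ xs, IsSolution L A S R γ g (Matrix.toEuclideanLin (S * spaceTimeMap A T) x + e) xs →
      ‖inBand U hk xs - x‖ ≤ inBandBound δ γ Mmax fk fk1 (g.eval σk) (g.eval σk1)
          ‖Matrix.toEuclideanLin R e‖ ‖x‖ ∧
      ‖outOfBand U hk xs‖ ≤ outOfBandBound γ (g.eval σk) (g.eval σk1)
          ‖Matrix.toEuclideanLin R e‖ ‖x‖ ∧
      (g.eval σk = 0 → e = 0 → xs = x)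

end Reconstruction

end GraphSampling

end

open GraphSampling

/-! The argument separates into a deterministic and a probabilistic half, joined by one inequality:
`‖R S Ũ w‖² ≥ (1 - δ)‖w‖²` for all `w`, with `R = P_Ω^{-1/2} 𝒲^{1/2}`. This event involves neither
`x`, `e`, `γ` nor `g`, which is why the guarantee is uniform in them.

Deterministic half (`reconstructionGuarantee_of_le`). The basis `U` diagonalizes both `π_{A,T}ᵀ
π_{A,T}` and `g(L)`. From `π_{A,T} U_k = Ũ diag(f_T(λ_l))` the data term is bounded below by `√(1 -
δ) f_T(λ_k)` in band; out of band it is bounded above by `M_max f_T(λ_{k+1})`, and there the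
regularizer dominates `g(σ_{k+1})‖β‖²`. Comparing the objective at the minimizer and at `x` then
gives the error bounds (`regularized_error_bounds`).

Probabilistic half (`sum_prod_chernoff`). Since `Ũ` has orthonormal columns, the reweighted samples
are independent positive operators with mean sum the identity, and a lower-tail matrix Chernoff
bound applies. It is proved without Golden-Thompson or Lieb. For positive `X` with `X² ≤ rX`, a
second-order estimate gives `tr e^{H-X} ≤ tr e^H - (1 - r/2) tr(X e^H)`. The right side is affine in
`X`, so it can be averaged, and by Klein's inequality the average is at most `tr e^{H-(1-r/2)𝔼X}`.
Hence each random summand may be replaced by `1 - r/2` times its mean, one draw at a time, and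
Markov's inequality finishes. -/

/-! ### Second-order calculus of the trace exponential. -/

section TraceExp

variable {E : Type*} [NormedAddCommGroup E] [InnerProductSpace ℝ E] [FiniteDimensional ℝ E]

/-- A second-order Taylor bound for the exponential, with the remainder split between the two
endpoints. -/
theorem Real.exp_sub_one_sub_le (d : ℝ) :
    Real.exp d - 1 - d ≤ d ^ 2 * (1 / 3 + Real.exp d / 6) := by
  -- The left side is the integral remainder `∫ d²(1-u)e^{ud}`. Convexity replaces `e^{ud}` by its
  -- chord, and `1/3`, `1/6` are the integrals of `(1-u)²` and `u(1-u)`.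
  have hconv : ∀ u ∈ Set.Icc (0 : ℝ) 1,
      d ^ 2 * (1 - u) * Real.exp (u * d) ≤ d ^ 2 * (1 - u) * ((1 - u) + u * Real.exp d) := by
    intro u hu
    have h := convexOn_exp.2 (Set.mem_univ (0 : ℝ)) (Set.mem_univ d)
      (sub_nonneg.2 hu.2) hu.1 (by ring)
    simp only [smul_eq_mul, mul_zero, zero_add, Real.exp_zero, mul_one] at h
    exact mul_le_mul_of_nonneg_left h (mul_nonneg (sq_nonneg d) (sub_nonneg.2 hu.2))
  have h1 : ∫ u in (0 : ℝ)..1, d ^ 2 * (1 - u) * Real.exp (u * d) = Real.exp d - 1 - d := by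
    rw [intervalIntegral.integral_eq_sub_of_hasDerivAt
      (f := fun u => d * (1 - u) * Real.exp (u * d) + Real.exp (u * d))]
    · simp; ring
    · intro u _
      have he : HasDerivAt (fun u : ℝ => Real.exp (u * d)) (Real.exp (u * d) * d) u := by
        simpa using ((hasDerivAt_id u).mul_const d).exp
      have hl : HasDerivAt (fun u : ℝ => d * (1 - u)) (-d) u := by
        simpa using ((hasDerivAt_id u).const_sub 1).const_mul d
      exact ((hl.mul he).add he).congr_deriv (by ring)
    · exact (by fun_prop : Continuous fun u : ℝ => d ^ 2 * (1 - u) * Real.exp (u * d)).intervalIntegrable _ _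
  have h2 : ∫ u in (0 : ℝ)..1, d ^ 2 * (1 - u) * ((1 - u) + u * Real.exp d)
      = d ^ 2 * (1 / 3 + Real.exp d / 6) := by
    rw [intervalIntegral.integral_eq_sub_of_hasDerivAt
      (f := fun u => d ^ 2 * ((u - u ^ 2 + u ^ 3 / 3) + (u ^ 2 / 2 - u ^ 3 / 3) * Real.exp d))]
    · ring
    · intro u _
      have h0 := hasDerivAt_id u
      exact ((((h0.sub (h0.pow 2)).add ((h0.pow 3).div_const 3)).add
        ((((h0.pow 2).div_const 2).sub ((h0.pow 3).div_const 3)).mul_const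
          (Real.exp d))).const_mul (d ^ 2)).congr_deriv (by simp; ring)
    · exact (by fun_prop : Continuous fun u : ℝ =>
        d ^ 2 * (1 - u) * ((1 - u) + u * Real.exp d)).intervalIntegrable _ _
  rw [← h1, ← h2]
  refine intervalIntegral.integral_mono_on zero_le_one ?_ ?_ hconv <;>
  · apply Continuous.intervalIntegrable
    fun_prop

namespace LinearMap.IsSymmetric

/-- The trace of the exponential of a symmetric operator. -/
noncomputable def traceExp {H : E →ₗ[ℝ] E} (hH : H.IsSymmetric) : ℝ :=
  ∑ i, Real.exp (hH.eigenvalues rfl i)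

/-- The trace of `X * exp H`, for a symmetric operator `H`. -/
noncomputable def traceExpMul {H : E →ₗ[ℝ] E} (hH : H.IsSymmetric) (X : E →ₗ[ℝ] E) : ℝ :=
  ∑ i, Real.exp (hH.eigenvalues rfl i) *
    inner ℝ (hH.eigenvectorBasis rfl i) (X (hH.eigenvectorBasis rfl i))

theorem traceExpMul_neg {H : E →ₗ[ℝ] E} (hH : H.IsSymmetric) (X : E →ₗ[ℝ] E) :
    hH.traceExpMul (-X) = -hH.traceExpMul X := by
  simp [traceExpMul]

theorem traceExpMul_smul {H : E →ₗ[ℝ] E} (hH : H.IsSymmetric) (a : ℝ) (X : E →ₗ[ℝ] E) :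
    hH.traceExpMul (a • X) = a * hH.traceExpMul X := by
  simp only [traceExpMul, LinearMap.smul_apply, inner_smul_right, Finset.mul_sum]
  exact Finset.sum_congr rfl fun i _ => by ring

theorem traceExpMul_sum {κ : Type*} {H : E →ₗ[ℝ] E} (hH : H.IsSymmetric) (s : Finset κ)
    (X : κ → E →ₗ[ℝ] E) :
    hH.traceExpMul (∑ c ∈ s, X c) = ∑ c ∈ s, hH.traceExpMul (X c) := by
  simp only [traceExpMul, LinearMap.sum_apply, inner_sum, Finset.mul_sum]
  exact Finset.sum_comm

theorem traceExpMul_mono {H X Y : E →ₗ[ℝ] E} (hH : H.IsSymmetric)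
    (h : ∀ v, inner ℝ v (X v) ≤ inner ℝ v (Y v)) : hH.traceExpMul X ≤ hH.traceExpMul Y :=
  Finset.sum_le_sum fun _ _ => mul_le_mul_of_nonneg_left (h _) (Real.exp_pos _).le

/-- Letting `H` act on the left vector and `M` on the right one converts eigenvalue gaps into
entries of `M - H`. This reduces trace inequalities for noncommuting operators to scalar
inequalities, weighted by squared overlaps. -/
theorem inner_eigenvectorBasis_sub {H M : E →ₗ[ℝ] E} (hH : H.IsSymmetric) (hM : M.IsSymmetric)
    (i j : Fin (Module.finrank ℝ E)) :
    inner ℝ (hH.eigenvectorBasis rfl i) ((M - H) (hM.eigenvectorBasis rfl j)) =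
      (hM.eigenvalues rfl j - hH.eigenvalues rfl i) *
        inner ℝ (hH.eigenvectorBasis rfl i) (hM.eigenvectorBasis rfl j) := by
  rw [LinearMap.sub_apply, inner_sub_right, ← hH, hM.apply_eigenvectorBasis,
    hH.apply_eigenvectorBasis]
  simp [inner_smul_left, inner_smul_right]
  ring

omit [FiniteDimensional ℝ E] in
theorem sum_inner_eigenvectorBasis_sq (b : OrthonormalBasis (Fin (Module.finrank ℝ E)) ℝ E)
    (v : E) : ∑ j, inner ℝ v (b j) ^ 2 = ‖v‖ ^ 2 := by
  simpa [real_inner_comm] using b.sum_sq_norm_inner_right v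

/-- The difference quotient of the exponential in the joint eigenbases. -/
theorem traceExp_sub_traceExp_sub_traceExpMul {H M : E →ₗ[ℝ] E} (hH : H.IsSymmetric)
    (hM : M.IsSymmetric) :
    hM.traceExp - hH.traceExp - hH.traceExpMul (M - H) =
      ∑ i, ∑ j, inner ℝ (hH.eigenvectorBasis rfl i) (hM.eigenvectorBasis rfl j) ^ 2 *
        (Real.exp (hM.eigenvalues rfl j) - Real.exp (hH.eigenvalues rfl i) -
          Real.exp (hH.eigenvalues rfl i) *
            (hM.eigenvalues rfl j - hH.eigenvalues rfl i)) := by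
  set u := hH.eigenvectorBasis rfl with hu
  set w := hM.eigenvectorBasis rfl with hw
  have h1 : hM.traceExp = ∑ i, ∑ j, inner ℝ (u i) (w j) ^ 2 * Real.exp (hM.eigenvalues rfl j) := by
    rw [Finset.sum_comm]
    refine Finset.sum_congr rfl fun j _ => ?_
    rw [← Finset.sum_mul]
    simp_rw [real_inner_comm (w j)]
    rw [sum_inner_eigenvectorBasis_sq]
    simp
  have h2 : hH.traceExp = ∑ i, ∑ j, inner ℝ (u i) (w j) ^ 2 * Real.exp (hH.eigenvalues rfl i) := by
    refine Finset.sum_congr rfl fun j _ => ?_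
    rw [← Finset.sum_mul, sum_inner_eigenvectorBasis_sq]
    simp
  have h3 : hH.traceExpMul (M - H) = ∑ i, ∑ j, inner ℝ (u i) (w j) ^ 2 *
      (Real.exp (hH.eigenvalues rfl i) * (hM.eigenvalues rfl j - hH.eigenvalues rfl i)) := by
    refine Finset.sum_congr rfl fun i _ => ?_
    have hsymm := hM.sub hH
    rw [← hsymm, ← w.sum_inner_mul_inner, Finset.mul_sum]
    refine Finset.sum_congr rfl fun j _ => ?_
    rw [hsymm, inner_eigenvectorBasis_sub, real_inner_comm (u i) (w j)]
    ring
  rw [h1, h2, h3]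
  simp only [← Finset.sum_sub_distrib]
  exact Finset.sum_congr rfl fun i _ => Finset.sum_congr rfl fun j _ => by ring

/-- Klein's inequality for the exponential: the trace exponential is convex. -/
theorem traceExp_add_traceExpMul_le {H M : E →ₗ[ℝ] E} (hH : H.IsSymmetric)
    (hM : M.IsSymmetric) : hH.traceExp + hH.traceExpMul (M - H) ≤ hM.traceExp := by
  have h := traceExp_sub_traceExp_sub_traceExpMul hH hM
  have : 0 ≤ hM.traceExp - hH.traceExp - hH.traceExpMul (M - H) := by
    rw [h]
    refine Finset.sum_nonneg fun i _ => Finset.sum_nonneg fun j _ => mul_nonneg (sq_nonneg _) ?_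
    set a := hH.eigenvalues rfl i
    set b := hM.eigenvalues rfl j
    have h1 := Real.add_one_le_exp (b - a)
    have h2 : Real.exp b = Real.exp a * Real.exp (b - a) := by rw [← Real.exp_add]; congr 1; ring
    rw [h2]
    nlinarith [Real.exp_pos a]
  linarith

theorem traceExpMul_comp_self {H X : E →ₗ[ℝ] E} (hH : H.IsSymmetric) (hX : X.IsSymmetric) :
    hH.traceExpMul (X ∘ₗ X) =
      ∑ i, Real.exp (hH.eigenvalues rfl i) * ‖X (hH.eigenvectorBasis rfl i)‖ ^ 2 := by
  refine Finset.sum_congr rfl fun i _ => ?_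
  rw [LinearMap.comp_apply, ← hX, real_inner_self_eq_norm_sq]

/-- The second-order upper bound for the trace exponential. -/
theorem traceExp_sub_le {H M : E →ₗ[ℝ] E} (hH : H.IsSymmetric) (hM : M.IsSymmetric) :
    hM.traceExp - hH.traceExp - hH.traceExpMul (M - H) ≤
      1 / 3 * hH.traceExpMul ((M - H) ∘ₗ (M - H)) +
        1 / 6 * hM.traceExpMul ((M - H) ∘ₗ (M - H)) := by
  have hK := hM.sub hH
  rw [traceExp_sub_traceExp_sub_traceExpMul, traceExpMul_comp_self hH hK,
    traceExpMul_comp_self hM hK]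
  set u := hH.eigenvectorBasis rfl with hu
  set w := hM.eigenvectorBasis rfl with hw
  have h1 : ∀ i, ‖(M - H) (u i)‖ ^ 2 = ∑ j, inner ℝ (u i) ((M - H) (w j)) ^ 2 := by
    intro i
    rw [← sum_inner_eigenvectorBasis_sq w]
    exact Finset.sum_congr rfl fun j _ => by rw [hK]
  have h2 : ∀ j, ‖(M - H) (w j)‖ ^ 2 = ∑ i, inner ℝ (u i) ((M - H) (w j)) ^ 2 := by
    intro j
    rw [← sum_inner_eigenvectorBasis_sq u]
    exact Finset.sum_congr rfl fun i _ => by rw [real_inner_comm]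
  simp_rw [h1, h2, Finset.mul_sum]
  rw [Finset.sum_comm (f := fun j i => 1 / 6 * (Real.exp (hM.eigenvalues rfl j) *
    inner ℝ (u i) ((M - H) (w j)) ^ 2))]
  simp only [← Finset.sum_add_distrib]
  refine Finset.sum_le_sum fun i _ => Finset.sum_le_sum fun j _ => ?_
  rw [inner_eigenvectorBasis_sub hH hM]
  set a := hH.eigenvalues rfl i
  set b := hM.eigenvalues rfl j
  have h2 : Real.exp b = Real.exp a * Real.exp (b - a) := by rw [← Real.exp_add]; congr 1; ring
  have h := mul_le_mul_of_nonneg_left (Real.exp_sub_one_sub_le (b - a))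
    (mul_nonneg (sq_nonneg (inner ℝ (u i) (w j))) (Real.exp_pos a).le)
  rw [h2]
  linarith

/-- The trace exponential decreases at least linearly under subtraction of a small positive
operator. -/
theorem traceExp_sub_le_of_sq_le {H X : E →ₗ[ℝ] E} (hH : H.IsSymmetric) (hX : X.IsSymmetric)
    {r : ℝ} (hr : 0 ≤ r) (hsq : ∀ v, ‖X v‖ ^ 2 ≤ r * inner ℝ v (X v)) :
    (hH.sub hX).traceExp ≤ hH.traceExp - (1 - r / 2) * hH.traceExpMul X := by
  have hM := hH.sub hX
  have hMH : H - X - H = -X := by abel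
  have hcc : (-X) ∘ₗ (-X) = X ∘ₗ X := by ext v; simp
  have h1 := traceExp_sub_le hH hM
  have h2 := traceExp_add_traceExpMul_le hH hM
  have h3 := traceExp_add_traceExpMul_le hM hH
  rw [hMH, hcc, traceExpMul_neg] at h1
  rw [hMH, traceExpMul_neg] at h2
  rw [sub_sub_cancel] at h3
  have hbd : ∀ v, inner ℝ v ((X ∘ₗ X) v) ≤ inner ℝ v ((r • X) v) := by
    intro v
    rw [LinearMap.comp_apply, ← hX, real_inner_self_eq_norm_sq, LinearMap.smul_apply,
      inner_smul_right]
    exact hsq v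
  have h4 := hH.traceExpMul_mono hbd
  have h5 := hM.traceExpMul_mono hbd
  rw [traceExpMul_smul] at h4 h5
  -- Klein's inequality from both endpoints: adding the two tangent bounds makes the trace
  -- exponentials cancel. So the share of the remainder at `H - X` is controlled at `H`, and `1/3 +
  -- 1/6` gives `r/2`.
  have h6 : hM.traceExpMul X ≤ hH.traceExpMul X := by linarith
  have h7 := mul_le_mul_of_nonneg_left h6 hr
  linarith

/-- If all eigenvalues were below `a`, the Rayleigh quotient could not exceed `a`; one eigenvalue of
size at least `a` already contributes `e^a`. The strict inequality also rules out `v = 0`. -/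
theorem exp_inner_le_traceExp {H : E →ₗ[ℝ] E} (hH : H.IsSymmetric) {a : ℝ} {v : E}
    (hv : a * ‖v‖ ^ 2 < inner ℝ v (H v)) : Real.exp a ≤ hH.traceExp := by
  obtain ⟨i, hi⟩ : ∃ i, a ≤ hH.eigenvalues rfl i := by
    by_contra! hcon
    refine absurd hv (not_lt.2 ?_)
    set u := hH.eigenvectorBasis rfl with hu
    rw [← sum_inner_eigenvectorBasis_sq u, ← u.sum_inner_mul_inner, Finset.mul_sum]
    refine Finset.sum_le_sum fun i _ => ?_
    rw [← hH, hH.apply_eigenvectorBasis, real_inner_comm (u i) v]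
    simp only [RCLike.ofReal_real_eq_id, id_eq, inner_smul_left, conj_trivial]
    rw [real_inner_comm v (u i)]
    nlinarith [hcon i, sq_nonneg (inner ℝ (u i) v)]
  calc Real.exp a ≤ Real.exp (hH.eigenvalues rfl i) := Real.exp_le_exp.2 hi
    _ ≤ _ := Finset.single_le_sum (f := fun i => Real.exp (hH.eigenvalues rfl i))
      (fun _ _ => (Real.exp_pos _).le) (Finset.mem_univ i)

theorem traceExp_of_eq_smul_id {H : E →ₗ[ℝ] E} (hH : H.IsSymmetric) {a : ℝ}
    (h : ∀ v, H v = a • v) : hH.traceExp = Module.finrank ℝ E * Real.exp a := by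
  have : ∀ i, hH.eigenvalues rfl i = a := by
    intro i
    have h1 := hH.apply_eigenvectorBasis rfl i
    rw [h] at h1
    exact (smul_left_injective ℝ ((hH.eigenvectorBasis rfl).orthonormal.ne_zero i) h1).symm
  simp [traceExp, this]

end LinearMap.IsSymmetric

end TraceExp

/-! ### Lower tail of the matrix Chernoff inequality. -/

section Chernoff

variable {E : Type*} [NormedAddCommGroup E] [InnerProductSpace ℝ E] [FiniteDimensional ℝ E]

namespace LinearMap.IsSymmetric

omit [FiniteDimensional ℝ E] in
theorem finset_sum {κ : Type*} {s : Finset κ} {X : κ → E →ₗ[ℝ] E}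
    (hX : ∀ c, (X c).IsSymmetric) : (∑ c ∈ s, X c).IsSymmetric := by
  intro v w
  simp only [LinearMap.sum_apply, sum_inner, inner_sum, hX _ v w]

omit [FiniteDimensional ℝ E] in
theorem smul_real {X : E →ₗ[ℝ] E} (hX : X.IsSymmetric) (a : ℝ) : (a • X).IsSymmetric := by
  intro v w
  simp only [LinearMap.smul_apply, real_inner_smul_left, real_inner_smul_right, hX v w]

theorem traceExp_congr {H M : E →ₗ[ℝ] E} (hH : H.IsSymmetric) (hM : M.IsSymmetric)
    (h : H = M) : hH.traceExp = hM.traceExp := by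
  subst h
  rfl

/-- The effect of one random subtraction on the expected trace exponential. -/
theorem sum_mul_traceExp_sub_le {κ : Type*} [Fintype κ] {q : κ → ℝ} (hq : ∀ c, 0 ≤ q c)
    (hq1 : ∑ c, q c = 1) {X : κ → E →ₗ[ℝ] E} (hX : ∀ c, (X c).IsSymmetric) {r : ℝ} (hr : 0 ≤ r)
    (hsq : ∀ c v, ‖X c v‖ ^ 2 ≤ r * inner ℝ v (X c v)) {H : E →ₗ[ℝ] E} (hH : H.IsSymmetric) :
    ∑ c, q c * (hH.sub (hX c)).traceExp ≤
      (hH.sub ((finset_sum (s := Finset.univ) fun c => (hX c).smul_real (q c)).smul_real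
        (1 - r / 2))).traceExp := by
  have hM := (hH.sub ((finset_sum (s := Finset.univ) fun c => (hX c).smul_real (q c)).smul_real
        (1 - r / 2)))
  calc ∑ c, q c * (hH.sub (hX c)).traceExp
      ≤ ∑ c, q c * (hH.traceExp - (1 - r / 2) * hH.traceExpMul (X c)) :=
        Finset.sum_le_sum fun c _ => mul_le_mul_of_nonneg_left
          (hH.traceExp_sub_le_of_sq_le (hX c) hr (hsq c)) (hq c)
    _ = hH.traceExp + hH.traceExpMul (-((1 - r / 2) • ∑ c, q c • X c)) := by
        rw [traceExpMul_neg, traceExpMul_smul, traceExpMul_sum]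
        simp only [traceExpMul_smul, mul_sub, Finset.sum_sub_distrib, ← Finset.sum_mul, hq1,
          one_mul, Finset.mul_sum, ← sub_eq_add_neg]
        congr 1
        exact Finset.sum_congr rfl fun c _ => by ring
    _ ≤ _ := by
        -- The averaged bound is the tangent of the trace exponential at `H`, so convexity puts it
        -- below the value at the shifted operator.
        have h := traceExp_add_traceExpMul_le hH hM
        rwa [sub_sub_cancel_left] at h

/-- The expected trace exponential after finitely many independent random subtractions. -/
theorem sum_prod_mul_traceExp_sub_le {κ : Type*} [Fintype κ] {m : ℕ} {q : Fin m → κ → ℝ}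
    (hq : ∀ j c, 0 ≤ q j c) (hq1 : ∀ j, ∑ c, q j c = 1) {X : Fin m → κ → E →ₗ[ℝ] E}
    (hX : ∀ j c, (X j c).IsSymmetric) {r : ℝ} (hr : 0 ≤ r)
    (hsq : ∀ j c v, ‖X j c v‖ ^ 2 ≤ r * inner ℝ v (X j c v))
    {H : E →ₗ[ℝ] E} (hH : H.IsSymmetric) :
    ∑ v : Fin m → κ, (∏ j, q j (v j)) *
        (hH.sub (finset_sum (s := Finset.univ) fun j => hX j (v j))).traceExp ≤
      (hH.sub ((finset_sum (s := Finset.univ) fun j =>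
        finset_sum (s := Finset.univ) fun c => (hX j c).smul_real (q j c)).smul_real
          (1 - r / 2))).traceExp := by
  induction m generalizing H with
  | zero =>
    simp only [Finset.univ_unique, Finset.univ_eq_empty, Finset.prod_empty, one_mul,
      Finset.sum_singleton]
    exact (traceExp_congr _ _ (by simp)).le
  | succ m ih =>
    -- Draw `0` is averaged with the others fixed, and its scaled mean is absorbed into `H`; this is
    -- why the induction runs over all `H`.
    have hK := hH.sub ((finset_sum (s := Finset.univ) fun c => (hX 0 c).smul_real
      (q 0 c)).smul_real (1 - r / 2))
    have hS : ∀ v : Fin m → κ, (H - ∑ j, X j.succ (v j)).IsSymmetric := fun v =>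
      hH.sub (finset_sum (s := Finset.univ) fun j => hX j.succ (v j))
    calc _ = ∑ v : Fin m → κ, (∏ j, q j.succ (v j)) *
          ∑ c, q 0 c * ((hS v).sub (hX 0 c)).traceExp := by
          rw [← (Fin.consEquiv fun _ : Fin (m + 1) => κ).sum_comp, Fintype.sum_prod_type,
            Finset.sum_comm]
          refine Finset.sum_congr rfl fun v _ => ?_
          rw [Finset.mul_sum]
          refine Finset.sum_congr rfl fun c _ => ?_
          rw [Fin.prod_univ_succ]
          simp only [Fin.consEquiv_apply, Fin.cons_zero, Fin.cons_succ]
          rw [mul_comm (q 0 c), mul_assoc]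
          congr 2
          refine traceExp_congr _ _ ?_
          rw [Fin.sum_univ_succ]
          simp only [Fin.cons_zero, Fin.cons_succ]
          abel
      _ ≤ ∑ v : Fin m → κ, (∏ j, q j.succ (v j)) *
          (hK.sub (finset_sum (s := Finset.univ) fun j => hX j.succ (v j))).traceExp := by
          refine Finset.sum_le_sum fun v _ => mul_le_mul_of_nonneg_left ?_
            (Finset.prod_nonneg fun j _ => hq _ _)
          refine (sum_mul_traceExp_sub_le (hq 0) (hq1 0) (hX 0) hr (hsq 0) (hS v)).trans
            (traceExp_congr _ _ ?_).le
          abel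
      _ ≤ _ := by
          refine (ih (fun j => hq j.succ) (fun j => hq1 j.succ) (fun j => hX j.succ)
            (fun j => hsq j.succ) hK).trans (traceExp_congr _ _ ?_).le
          rw [Fin.sum_univ_succ, smul_add]
          abel

end LinearMap.IsSymmetric

/-- Take `Y = B*B`: then `‖B*Bv‖² ≤ ‖B‖²‖Bv‖²`, which is the condition `Y² ≤ bY` required by the
trace exponential bound. -/
theorem exists_isSymmetric_inner_eq {F : Type*} [NormedAddCommGroup F] [InnerProductSpace ℝ F]
    [CompleteSpace F] (B : E →L[ℝ] F) {b : ℝ} (hB : ‖B‖ ^ 2 ≤ b) :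
    ∃ Y : E →ₗ[ℝ] E, Y.IsSymmetric ∧ (∀ v w, inner ℝ v (Y w) = inner ℝ (B v) (B w)) ∧
      ∀ v, ‖Y v‖ ^ 2 ≤ b * inner ℝ v (Y v) := by
  have hin : ∀ v w, inner ℝ v (ContinuousLinearMap.adjoint B (B w)) = inner ℝ (B v) (B w) :=
    fun v w => ContinuousLinearMap.adjoint_inner_right _ _ _
  obtain ⟨Y, hY⟩ : ∃ Y : E →ₗ[ℝ] E, ∀ v, Y v = ContinuousLinearMap.adjoint B (B v) :=
    ⟨(ContinuousLinearMap.adjoint B : F →ₗ[ℝ] E) ∘ₗ (B : E →ₗ[ℝ] F), fun _ => rfl⟩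
  simp_rw [← hY] at hin
  refine ⟨Y, ?_, hin, ?_⟩
  · intro v w
    rw [hin, hY, ContinuousLinearMap.adjoint_inner_left]
  · intro v
    have h1 : ‖ContinuousLinearMap.adjoint B (B v)‖ ≤ ‖B‖ * ‖B v‖ := by
      have hn : ‖ContinuousLinearMap.adjoint B‖ = ‖B‖ := LinearIsometryEquiv.norm_map _ B
      exact hn ▸ (ContinuousLinearMap.adjoint B).le_opNorm (B v)
    rw [hin, real_inner_self_eq_norm_sq, hY]
    calc ‖ContinuousLinearMap.adjoint B (B v)‖ ^ 2 ≤ (‖B‖ * ‖B v‖) ^ 2 := by gcongr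
      _ = ‖B‖ ^ 2 * ‖B v‖ ^ 2 := mul_pow _ _ _
      _ ≤ _ := mul_le_mul_of_nonneg_right hB (sq_nonneg _)

/-- Exponential Markov inequality for `tr exp(-θ ∑ B*B)`: on the bad set the trace is at least
`e^{-θ(1-δ)}`, while its expectation is at most `dim E · e^{-(1-δ/2)θ}`. -/
theorem sum_prod_chernoff {F κ : Type*} [NormedAddCommGroup F]
    [InnerProductSpace ℝ F] [CompleteSpace F] [Fintype κ] {m : ℕ} {q : Fin m → κ → ℝ}
    (hq : ∀ j c, 0 ≤ q j c) (hq1 : ∀ j, ∑ c, q j c = 1) (B : Fin m → κ → E →L[ℝ] F) {b : ℝ}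
    (hb : 0 < b) (hB : ∀ j c, ‖B j c‖ ^ 2 ≤ b)
    (hsum : ∀ w, ∑ j, ∑ c, q j c * ‖B j c w‖ ^ 2 = ‖w‖ ^ 2) {δ : ℝ} (hδ : 0 < δ)
    (A : Finset (Fin m → κ))
    (hA : ∀ v ∈ A, ∃ w, ∑ j, ‖B j (v j) w‖ ^ 2 < (1 - δ) * ‖w‖ ^ 2) :
    ∑ v ∈ A, ∏ j, q j (v j) ≤ Module.finrank ℝ E * Real.exp (-(δ ^ 2 / (2 * b))) := by
  classical
  -- This `θ` minimizes the exponent `-θδ + θ²b/2`; it makes the parameter `r = θb` equal to `δ`.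
  set θ := δ / b with hθ
  have hθ0 : 0 < θ := div_pos hδ hb
  choose Y hYsymm hYin hYsq using fun j c => exists_isSymmetric_inner_eq (B j c) (hB j c)
  have hX : ∀ j c, (θ • Y j c).IsSymmetric := fun j c => (hYsymm j c).smul_real θ
  have hXsq : ∀ j c v, ‖(θ • Y j c) v‖ ^ 2 ≤ δ * inner ℝ v ((θ • Y j c) v) := by
    intro j c v
    have hd : δ = θ * b := by rw [hθ]; field_simp
    rw [LinearMap.smul_apply, norm_smul, inner_smul_right, mul_pow, Real.norm_eq_abs, sq_abs]
    calc θ ^ 2 * ‖Y j c v‖ ^ 2 ≤ θ ^ 2 * (b * inner ℝ v (Y j c v)) :=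
          mul_le_mul_of_nonneg_left (hYsq j c v) (sq_nonneg θ)
      _ = _ := by rw [hd]; ring
  have hmean : ∑ j, ∑ c, q j c • Y j c = LinearMap.id := by
    rw [← sub_eq_zero]
    -- A symmetric operator is determined by its quadratic form, so `hsum` identifies the mean with
    -- the identity.
    have hs : (∑ j, ∑ c, q j c • Y j c - LinearMap.id).IsSymmetric :=
      (LinearMap.IsSymmetric.finset_sum (s := Finset.univ) fun j =>
        LinearMap.IsSymmetric.finset_sum (s := Finset.univ) fun c =>
          (hYsymm j c).smul_real (q j c)).sub LinearMap.IsSymmetric.id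
    rw [← hs.inner_map_self_eq_zero]
    intro w
    rw [real_inner_comm, LinearMap.sub_apply, inner_sub_right, LinearMap.id_apply,
      real_inner_self_eq_norm_sq, ← hsum w, sub_eq_zero]
    simp only [LinearMap.sum_apply, inner_sum, LinearMap.smul_apply, inner_smul_right, hYin,
      real_inner_self_eq_norm_sq]
  have h0 : (0 : E →ₗ[ℝ] E).IsSymmetric := LinearMap.IsSymmetric.zero
  have hmain := LinearMap.IsSymmetric.sum_prod_mul_traceExp_sub_le hq hq1 hX hδ.le hXsq h0
  rw [LinearMap.IsSymmetric.traceExp_of_eq_smul_id (a := -((1 - δ / 2) * θ))] at hmain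
  swap
  · intro v
    have h1 : ∑ j, ∑ c, q j c • θ • Y j c = θ • LinearMap.id := by
      simp_rw [smul_comm _ θ, ← Finset.smul_sum]
      rw [hmean]
    rw [h1]
    simp [mul_smul]
  have hpos : 0 < Real.exp (-(θ * (1 - δ))) := Real.exp_pos _
  have hlow : Real.exp (-(θ * (1 - δ))) * ∑ v ∈ A, ∏ j, q j (v j) ≤
      ∑ v : Fin m → κ, (∏ j, q j (v j)) * (h0.sub (LinearMap.IsSymmetric.finset_sum
        (s := Finset.univ) fun j => hX j (v j))).traceExp := by
    rw [Finset.mul_sum]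
    refine (Finset.sum_le_sum fun v hv => ?_).trans
      (Finset.sum_le_sum_of_subset_of_nonneg (Finset.subset_univ A) fun v _ _ =>
        mul_nonneg (Finset.prod_nonneg fun j _ => hq _ _)
          (Finset.sum_nonneg fun _ _ => (Real.exp_pos _).le))
    rw [mul_comm]
    refine mul_le_mul_of_nonneg_left ?_ (Finset.prod_nonneg fun j _ => hq _ _)
    obtain ⟨w, hw⟩ := hA v hv
    refine LinearMap.IsSymmetric.exp_inner_le_traceExp _ (v := w) ?_
    simp only [zero_sub, LinearMap.neg_apply, inner_neg_right, LinearMap.sum_apply, inner_sum,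
      LinearMap.smul_apply, inner_smul_right, hYin, real_inner_self_eq_norm_sq]
    rw [← Finset.mul_sum]
    nlinarith
  have h := hlow.trans hmain
  rw [mul_comm, ← le_div_iff₀ hpos, mul_div_assoc, ← Real.exp_sub] at h
  have hexp : -((1 - δ / 2) * θ) - -(θ * (1 - δ)) = -(δ ^ 2 / (2 * b)) := by
    rw [hθ]
    field_simp
    ring
  rwa [hexp] at h

theorem measureReal_mem_le_sum_prod {ι κ Ω : Type*} [Fintype ι] [Finite κ]
    [MeasurableSpace κ] [MeasurableSingletonClass κ] [MeasurableSpace Ω] {μ : Measure Ω}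
    [IsProbabilityMeasure μ] {q : ι → κ → ℝ} {ω : ι → Ω → κ} (hω : IsIndependentDraw μ q ω)
    (A : Finset (ι → κ)) :
    μ.real {s | (fun j => ω j s) ∈ A} ≤ ∑ v ∈ A, ∏ j, q j (v j) := by
  have h1 : {s | (fun j => ω j s) ∈ A} = ⋃ v ∈ A, {s | ∀ j, ω j s = v j} := by
    ext s
    simp only [Set.mem_ofPred_eq, Set.mem_iUnion, exists_prop]
    constructor
    · exact fun h => ⟨_, h, fun _ => rfl⟩
    · rintro ⟨v, hv, h⟩
      rwa [funext h]
  rw [h1]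
  refine (measureReal_biUnion_finset_le _ _).trans (Finset.sum_le_sum fun v _ => le_of_eq ?_)
  have h2 := hω.indep.measure_inter_preimage_eq_mul Finset.univ (sets := fun j => {v j})
    (fun j _ => measurableSet_singleton _)
  have h3 : {s | ∀ j, ω j s = v j} = ⋂ j ∈ Finset.univ, ω j ⁻¹' {v j} := by
    ext s
    simp
  rw [h3, measureReal_def, h2, ENNReal.toReal_prod]
  exact Finset.prod_congr rfl fun j _ => hω.law j (v j)

/-- The lower tail of the matrix Chernoff inequality, for independent draws from a finite set. -/
theorem measureReal_sum_norm_sq_lt_le {F ι κ Ω : Type*} [NormedAddCommGroup F]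
    [InnerProductSpace ℝ F] [CompleteSpace F] [Fintype ι] [Fintype κ]
    [MeasurableSpace κ] [MeasurableSingletonClass κ] [MeasurableSpace Ω] {μ : Measure Ω}
    [IsProbabilityMeasure μ] {q : ι → κ → ℝ} {ω : ι → Ω → κ} (hω : IsIndependentDraw μ q ω)
    (hq : ∀ j c, 0 ≤ q j c) (hq1 : ∀ j, ∑ c, q j c = 1) (B : ι → κ → E →L[ℝ] F) {b : ℝ}
    (hb : 0 < b) (hB : ∀ j c, ‖B j c‖ ^ 2 ≤ b)
    (hsum : ∀ w, ∑ j, ∑ c, q j c * ‖B j c w‖ ^ 2 = ‖w‖ ^ 2) {δ : ℝ} (hδ : 0 < δ) :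
    μ.real {s | ∃ w, ∑ j, ‖B j (ω j s) w‖ ^ 2 < (1 - δ) * ‖w‖ ^ 2} ≤
      Module.finrank ℝ E * Real.exp (-(δ ^ 2 / (2 * b))) := by
  classical
  -- The induction over draws needs them indexed by `Fin m`; independence survives the reindexing.
  let e := (Fintype.equivFin ι).symm
  have hω' : IsIndependentDraw μ (fun j => q (e j)) (fun j => ω (e j)) :=
    ⟨fun j => hω.measurable _, hω.indep.precomp e.injective, fun j c => hω.law _ c⟩
  let A : Finset (Fin (Fintype.card ι) → κ) :=
    {v | ∃ w, ∑ j, ‖B (e j) (v j) w‖ ^ 2 < (1 - δ) * ‖w‖ ^ 2}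
  have h := measureReal_mem_le_sum_prod hω' A
  have h2 : {s | (fun j => ω (e j) s) ∈ A} =
      {s | ∃ w, ∑ j, ‖B j (ω j s) w‖ ^ 2 < (1 - δ) * ‖w‖ ^ 2} := by
    ext s
    simp only [A, Finset.mem_filter, Finset.mem_univ, true_and, Set.mem_ofPred_eq]
    exact exists_congr fun w => by rw [← e.sum_comp]
  rw [h2] at h
  refine h.trans (sum_prod_chernoff (fun j => hq (e j)) (fun j => hq1 (e j))
    (fun j => B (e j)) hb (fun j => hB (e j)) ?_ hδ A fun v hv => (Finset.mem_filter.1 hv).2)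
  intro w
  rw [← hsum w, ← e.sum_comp]

end Chernoff

/-! ### Regularized least squares in inner product spaces. -/

section RegularizedLeastSquares

variable {E F : Type*} [NormedAddCommGroup E] [InnerProductSpace ℝ E] [FiniteDimensional ℝ E]
  [NormedAddCommGroup F] [InnerProductSpace ℝ F] [FiniteDimensional ℝ F]

/-- A regularized least squares problem with a positive definite quadratic part has exactly one
solution. -/
theorem existsUnique_isMin_regularized {Φ : E →ₗ[ℝ] F} {G : E →ₗ[ℝ] E} (hG : G.IsSymmetric)
    {γ : ℝ} (hpos : ∀ z, z ≠ 0 → 0 < ‖Φ z‖ ^ 2 + γ * inner ℝ z (G z)) (y : F) :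
    ∃! xs, ∀ z, ‖Φ xs - y‖ ^ 2 + γ * inner ℝ xs (G xs) ≤
      ‖Φ z - y‖ ^ 2 + γ * inner ℝ z (G z) := by
  -- The operator of the normal equations. Positivity makes it injective, hence surjective in finite
  -- dimension.
  let B : E →ₗ[ℝ] E := LinearMap.adjoint Φ ∘ₗ Φ + γ • G
  have hB : ∀ v z, inner ℝ v (B z) = inner ℝ (Φ v) (Φ z) + γ * inner ℝ v (G z) := by
    intro v z
    simp only [B, LinearMap.add_apply, LinearMap.comp_apply, LinearMap.smul_apply,
      inner_add_right, inner_smul_right, LinearMap.adjoint_inner_right]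
  have hinj : Function.Injective B := by
    rw [injective_iff_map_eq_zero]
    intro z hz
    by_contra hne
    have h1 := hpos z hne
    rw [← real_inner_self_eq_norm_sq, ← hB, hz, inner_zero_right] at h1
    exact lt_irrefl _ h1
  obtain ⟨xs, hxs⟩ := LinearMap.injective_iff_surjective.1 hinj (LinearMap.adjoint Φ y)
  have hopt : ∀ d, inner ℝ (Φ d) (Φ xs - y) + γ * inner ℝ d (G xs) = 0 := by
    intro d
    have h1 := hB d xs
    rw [hxs, LinearMap.adjoint_inner_right] at h1
    rw [inner_sub_right]
    linarith
  -- Completing the square at `xs`: the excess is the positive form at `z - xs`, which gives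
  -- minimality and uniqueness together.
  have key : ∀ z, ‖Φ z - y‖ ^ 2 + γ * inner ℝ z (G z) =
      ‖Φ xs - y‖ ^ 2 + γ * inner ℝ xs (G xs) +
        (‖Φ (z - xs)‖ ^ 2 + γ * inner ℝ (z - xs) (G (z - xs))) := by
    intro z
    have h1 : Φ z - y = (Φ xs - y) + Φ (z - xs) := by rw [map_sub]; abel
    have h2 : inner ℝ z (G z) = inner ℝ xs (G xs) + 2 * inner ℝ (z - xs) (G xs) +
        inner ℝ (z - xs) (G (z - xs)) := by
      have h3 : inner ℝ xs (G z) = inner ℝ z (G xs) := by rw [← hG, real_inner_comm]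
      simp only [map_sub, inner_sub_left, inner_sub_right, h3]
      ring
    have h4 := hopt (z - xs)
    rw [h1, norm_add_sq_real, h2, real_inner_comm]
    linear_combination 2 * h4
  refine ⟨xs, fun z => ?_, fun z hz => ?_⟩
  · rw [key z]
    rcases eq_or_ne (z - xs) 0 with h | h
    · simp [h]
    · linarith [hpos _ h]
  · by_contra hne
    have h1 := hz xs
    have h2 := hpos _ (sub_ne_zero.2 hne)
    linarith [key z]

omit [FiniteDimensional ℝ E] [FiniteDimensional ℝ F] in
/-- Error bounds for a regularized least squares problem, with the error decomposed into a part on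
which the data term is bounded below and a part that is controlled by the regularizer. -/
theorem regularized_error_bounds {Φ : E →ₗ[ℝ] F} {G : E →ₗ[ℝ] E} {γ : ℝ} (hγ : 0 < γ)
    {K : Submodule ℝ E} {a b : E → E} (ha : ∀ z, a z ∈ K) (hab : ∀ z, a z + b z = z)
    {c C g₀ g₁ : ℝ} (hc : 0 < c) (hC : 0 ≤ C) (hg₁ : 0 < g₁)
    (hΦa : ∀ z ∈ K, c * ‖z‖ ≤ ‖Φ z‖) (hΦb : ∀ z, ‖Φ (b z)‖ ≤ C * ‖b z‖)
    (hGb : ∀ z, g₁ * ‖b z‖ ^ 2 ≤ inner ℝ z (G z)) {x : E} (hx : x ∈ K)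
    (hGx : inner ℝ x (G x) ≤ g₀ * ‖x‖ ^ 2) (hg₀ : 0 ≤ g₀) (e : F) {xs : E}
    (hxs : ‖Φ xs - (Φ x + e)‖ ^ 2 + γ * inner ℝ xs (G xs) ≤
      ‖Φ x - (Φ x + e)‖ ^ 2 + γ * inner ℝ x (G x)) :
    ‖a xs - x‖ ≤ 1 / c * (2 + C / √(γ * g₁)) * ‖e‖ +
        1 / c * (C * √(g₀ / g₁) + √(γ * g₀)) * ‖x‖ ∧
      ‖b xs‖ ≤ 1 / √(γ * g₁) * ‖e‖ + √(g₀ / g₁) * ‖x‖ := by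
  have h0 : Φ x - (Φ x + e) = -e := by abel
  rw [h0, norm_neg] at hxs
  have hs₀ : √(γ * g₀) ^ 2 = γ * g₀ := Real.sq_sqrt (by positivity)
  have hs₁ : √(γ * g₁) ^ 2 = γ * g₁ := Real.sq_sqrt (by positivity)
  have hs₁pos : 0 < √(γ * g₁) := Real.sqrt_pos.2 (by positivity)
  -- `t²` dominates the objective at `x`, so `t` bounds both the residual at `xs` and `√(γ g₁)‖b
  -- xs‖`.
  set t := ‖e‖ + √(γ * g₀) * ‖x‖ with ht
  have ht0 : 0 ≤ t := by positivity
  have hrhs : ‖e‖ ^ 2 + γ * inner ℝ x (G x) ≤ t ^ 2 := by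
    have h1 : γ * inner ℝ x (G x) ≤ γ * (g₀ * ‖x‖ ^ 2) := mul_le_mul_of_nonneg_left hGx hγ.le
    have h2 : 0 ≤ ‖e‖ * (√(γ * g₀) * ‖x‖) := by positivity
    have h3 : t ^ 2 = ‖e‖ ^ 2 + 2 * (‖e‖ * (√(γ * g₀) * ‖x‖)) + √(γ * g₀) ^ 2 * ‖x‖ ^ 2 := by
      rw [ht]; ring
    rw [h3, hs₀]
    linarith
  have hGxs : γ * (g₁ * ‖b xs‖ ^ 2) ≤ γ * inner ℝ xs (G xs) :=
    mul_le_mul_of_nonneg_left (hGb xs) hγ.le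
  have hb1 : √(γ * g₁) * ‖b xs‖ ≤ t := by
    refine abs_le_of_sq_le_sq' ?_ ht0 |>.2
    rw [mul_pow, hs₁]
    linarith [sq_nonneg ‖Φ xs - (Φ x + e)‖]
  have hres : ‖Φ xs - (Φ x + e)‖ ≤ t := by
    refine abs_le_of_sq_le_sq' ?_ ht0 |>.2
    have : 0 ≤ γ * (g₁ * ‖b xs‖ ^ 2) := by positivity
    linarith
  have hquot : √(g₀ / g₁) = √(γ * g₀) / √(γ * g₁) := by
    rw [← Real.sqrt_div (by positivity), mul_div_mul_left _ _ hγ.ne']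
  have hb : ‖b xs‖ ≤ 1 / √(γ * g₁) * ‖e‖ + √(g₀ / g₁) * ‖x‖ := by
    have h1 : 1 / √(γ * g₁) * ‖e‖ + √(g₀ / g₁) * ‖x‖ = t / √(γ * g₁) := by
      rw [hquot, ht]
      ring
    rw [h1, le_div_iff₀ hs₁pos, mul_comm]
    exact hb1
  refine ⟨?_, hb⟩
  -- The noise enters once through the residual bound `t` and once through `e` itself, hence the
  -- constant `2`.
  have hdecomp : Φ (a xs - x) = (Φ xs - (Φ x + e)) + e - Φ (b xs) := by
    nth_rewrite 2 [← hab xs]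
    rw [map_sub, map_add]
    abel
  have h1 : c * ‖a xs - x‖ ≤ t + ‖e‖ + C * ‖b xs‖ := by
    refine (hΦa _ (K.sub_mem (ha xs) hx)).trans ?_
    rw [hdecomp]
    exact (norm_sub_le _ _).trans (add_le_add ((norm_add_le _ _).trans (by gcongr)) (hΦb xs))
  have h2 : C * ‖b xs‖ ≤ C * (1 / √(γ * g₁) * ‖e‖ + √(g₀ / g₁) * ‖x‖) :=
    mul_le_mul_of_nonneg_left hb hC
  have h3 : 1 / c * (2 + C / √(γ * g₁)) * ‖e‖ + 1 / c * (C * √(g₀ / g₁) + √(γ * g₀)) * ‖x‖ =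
      (t + ‖e‖ + C * (1 / √(γ * g₁) * ‖e‖ + √(g₀ / g₁) * ‖x‖)) / c := by
    rw [ht]
    ring
  rw [h3, le_div_iff₀ hc, mul_comm]
  linarith

end RegularizedLeastSquares

namespace GraphSampling

/-! ### Functions of the Laplacian in the eigenbasis. -/

section Spectral

variable {n : ℕ} {W U : Matrix (Fin n) (Fin n) ℝ} {σ : Fin n → ℝ}

theorem IsEigendecomposition.transpose_mul_self (hU : IsEigendecomposition W U σ) :
    Uᵀ * U = 1 := (Matrix.mem_orthogonalGroup_iff' (Fin n) ℝ).1 hU.orthogonal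

theorem IsEigendecomposition.mul_transpose_self (hU : IsEigendecomposition W U σ) :
    U * Uᵀ = 1 := (Matrix.mem_orthogonalGroup_iff (Fin n) ℝ).1 hU.orthogonal

theorem conj_diagonal_pow (hU : Uᵀ * U = 1) (h' : U * Uᵀ = 1) (d : Fin n → ℝ) (t : ℕ) :
    (U * diagonal d * Uᵀ) ^ t = U * diagonal (fun i => d i ^ t) * Uᵀ := by
  induction t with
  | zero => simp [h']
  | succ t ih =>
    rw [pow_succ, ih]
    calc U * diagonal (fun i => d i ^ t) * Uᵀ * (U * diagonal d * Uᵀ)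
        = U * diagonal (fun i => d i ^ t) * (Uᵀ * U) * diagonal d * Uᵀ := by
          simp only [Matrix.mul_assoc]
      _ = _ := by
          rw [hU, Matrix.mul_one, Matrix.mul_assoc U, diagonal_mul_diagonal]
          simp only [pow_succ]

theorem IsEigendecomposition.evolution_eq (hU : IsEigendecomposition W U σ) (dt : ℝ) :
    evolution W dt = U * diagonal (evolutionEigenvalue σ dt) * Uᵀ := by
  have hinv : U⁻¹ = Uᵀ := Matrix.inv_eq_right_inv hU.mul_transpose_self
  have hunit : IsUnit U := IsUnit.of_mul_eq_one _ hU.mul_transpose_self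
  have h1 : (-dt) • laplacian W = U * diagonal (fun i => -dt * σ i) * U⁻¹ := by
    rw [hU.eq, hinv, ← Matrix.smul_mul, ← Matrix.mul_smul, ← diagonal_smul]
    rfl
  rw [evolution, h1, Matrix.exp_conj _ _ hunit, Matrix.exp_diagonal, hinv]
  congr 3
  ext i
  rw [Pi.coe_exp, ← Real.exp_eq_exp_ℝ]
  rfl

theorem IsEigendecomposition.aeval_eq (hU : IsEigendecomposition W U σ) (g : Polynomial ℝ) :
    Polynomial.aeval (laplacian W) g = U * diagonal (fun i => g.eval (σ i)) * Uᵀ := by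
  rw [hU.eq]
  induction g using Polynomial.induction_on' with
  | add p q hp hq =>
    rw [map_add, hp, hq, ← Matrix.add_mul, ← Matrix.mul_add, diagonal_add]
    simp
  | monomial t a =>
    rw [Polynomial.aeval_monomial, conj_diagonal_pow hU.transpose_mul_self hU.mul_transpose_self,
      Algebra.algebraMap_eq_smul_one, Matrix.smul_mul, Matrix.one_mul, ← Matrix.smul_mul,
      ← Matrix.mul_smul, ← diagonal_smul]
    simp only [Polynomial.eval_monomial]
    rfl

/-- The sign and monotonicity of `g` are assumed only on the spectrum, so they can be used only at
points known to lie there. -/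
theorem IsEigendecomposition.mem_spectrum (hU : IsEigendecomposition W U σ) (i : Fin n) :
    σ i ∈ spectrum ℝ (laplacian W) := by
  have hunit : IsUnit U := IsUnit.of_mul_eq_one _ hU.mul_transpose_self
  have hinv : (↑hunit.unit⁻¹ : Matrix (Fin n) (Fin n) ℝ) = Uᵀ := by
    rw [Matrix.coe_units_inv, hunit.unit_spec]
    exact Matrix.inv_eq_right_inv hU.mul_transpose_self
  have h := spectrum.units_conjugate (R := ℝ) (a := diagonal σ) (u := hunit.unit)
  rw [hunit.unit_spec, hinv, ← hU.eq] at h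
  rw [h, spectrum_diagonal]
  exact ⟨i, rfl⟩

end Spectral

/-! ### Euclidean norms of matrix actions. -/

section Norms

variable {ι κ τ : Type*} [Fintype κ] [Fintype τ] [DecidableEq κ]

theorem toEuclideanLin_mul_apply [DecidableEq τ] (A : Matrix ι κ ℝ) (B : Matrix κ τ ℝ)
    (z : EuclideanSpace ℝ τ) :
    toEuclideanLin (A * B) z = toEuclideanLin A (toEuclideanLin B z) := by
  simp [toEuclideanLin]

theorem norm_toEuclideanLin_of_transpose_mul_self [Fintype ι] {A : Matrix ι κ ℝ} (hA : Aᵀ * A = 1)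
    (z : EuclideanSpace ℝ κ) : ‖toEuclideanLin A z‖ = ‖z‖ := by
  have h : ‖toEuclideanLin A z‖ ^ 2 = ‖z‖ ^ 2 := by
    rw [EuclideanSpace.real_norm_sq_eq, EuclideanSpace.real_norm_sq_eq]
    have h1 : (A *ᵥ z.ofLp) ⬝ᵥ (A *ᵥ z.ofLp) = z.ofLp ⬝ᵥ z.ofLp := by
      rw [Matrix.dotProduct_mulVec, ← Matrix.mulVec_transpose, Matrix.mulVec_mulVec, hA,
        Matrix.one_mulVec]
    simpa [dotProduct, pow_two] using h1
  exact (sq_eq_sq₀ (norm_nonneg _) (norm_nonneg _)).1 h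

theorem norm_toEuclideanLin_le_specNorm [Fintype ι] (A : Matrix ι κ ℝ) (z : EuclideanSpace ℝ κ) :
    ‖toEuclideanLin A z‖ ≤ specNorm A * ‖z‖ :=
  (LinearMap.toContinuousLinearMap (toEuclideanLin A)).le_opNorm z

end Norms

end GraphSampling

namespace GraphSampling

/-! ### Bandlimited signals and their complement in spectral coordinates. -/

section Spectral

variable {n : ℕ} {W U : Matrix (Fin n) (Fin n) ℝ} {σ : Fin n → ℝ} {k : ℕ}

theorem IsEigendecomposition.firstCols_transpose_mul_self (hU : IsEigendecomposition W U σ)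
    (hk : k < n) : (firstCols U hk)ᵀ * firstCols U hk = 1 := by
  have h : (firstCols U hk)ᵀ * firstCols U hk =
      (Uᵀ * U).submatrix (Fin.castLE hk.le) (Fin.castLE hk.le) := rfl
  rw [h, hU.transpose_mul_self, Matrix.submatrix_one _ (Fin.castLE_injective hk.le)]

/-- Seen in the full basis `U`, the band projection is a cutoff at index `k`, so in-band and
out-of-band parts can be compared coordinate by coordinate. -/
theorem firstCols_mul_transpose (U : Matrix (Fin n) (Fin n) ℝ) (hk : k < n) :
    firstCols U hk * (firstCols U hk)ᵀ =
      U * diagonal (fun i : Fin n => if (i : ℕ) < k then 1 else 0) * Uᵀ := by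
  ext i j
  have h : ∑ l : Fin k, U i (Fin.castLE hk.le l) * U j (Fin.castLE hk.le l) =
      ∑ l with ((l : Fin n) : ℕ) < k, U i l * U j l := by
    refine Finset.sum_nbij (Fin.castLE hk.le) (fun l _ => by simp)
      (Fin.castLE_injective hk.le).injOn (fun l hl => ?_) (fun _ _ => rfl)
    have hl' : (l : ℕ) < k := by simpa using hl
    exact ⟨⟨l, hl'⟩, by simp, rfl⟩
  rw [Matrix.mul_apply, Matrix.mul_apply]
  simp only [Matrix.mul_diagonal, Matrix.transpose_apply, firstCols, Matrix.submatrix_apply, id]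
  rw [h, Finset.sum_filter]
  exact Finset.sum_congr rfl fun l _ => by split_ifs <;> simp

theorem mem_bandlimited_iff (U : Matrix (Fin n) (Fin n) ℝ) (hk : k < n)
    (x : EuclideanSpace ℝ (Fin n)) :
    x ∈ bandlimited U hk ↔ ∃ d, toEuclideanLin (firstCols U hk) d = x := by
  have h : ∀ d : EuclideanSpace ℝ (Fin k), toEuclideanLin (firstCols U hk) d =
      ∑ l, d l • WithLp.toLp 2 fun i => firstCols U hk i l := by
    intro d
    ext i
    simp [toEuclideanLin, mulVec, dotProduct, mul_comm]
  rw [bandlimited, Submodule.mem_span_range_iff_exists_fun]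
  constructor
  · rintro ⟨d, hd⟩
    exact ⟨WithLp.toLp 2 d, (h _).trans hd⟩
  · rintro ⟨d, hd⟩
    exact ⟨d, (h d).symm.trans hd⟩

theorem inBand_mem_bandlimited (U : Matrix (Fin n) (Fin n) ℝ) (hk : k < n)
    (z : EuclideanSpace ℝ (Fin n)) : inBand U hk z ∈ bandlimited U hk := by
  rw [mem_bandlimited_iff, inBand, toEuclideanLin_mul_apply]
  exact ⟨_, rfl⟩

theorem inBand_add_outOfBand (U : Matrix (Fin n) (Fin n) ℝ) (hk : k < n)
    (z : EuclideanSpace ℝ (Fin n)) : inBand U hk z + outOfBand U hk z = z := by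
  rw [inBand, outOfBand, ← LinearMap.add_apply, ← map_add]
  simp [toEuclideanLin]

theorem IsEigendecomposition.outOfBand_eq_zero (hU : IsEigendecomposition W U σ) (hk : k < n)
    {x : EuclideanSpace ℝ (Fin n)} (hx : x ∈ bandlimited U hk) : outOfBand U hk x = 0 := by
  obtain ⟨d, rfl⟩ := (mem_bandlimited_iff U hk x).1 hx
  rw [outOfBand, ← toEuclideanLin_mul_apply, Matrix.sub_mul, Matrix.mul_assoc,
    hU.firstCols_transpose_mul_self]
  simp

theorem IsEigendecomposition.transpose_outOfBand_apply (hU : IsEigendecomposition W U σ)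
    (hk : k < n) (z : EuclideanSpace ℝ (Fin n)) (i : Fin n) :
    toEuclideanLin Uᵀ (outOfBand U hk z) i =
      if (i : ℕ) < k then 0 else toEuclideanLin Uᵀ z i := by
  have h : Uᵀ * (1 - firstCols U hk * (firstCols U hk)ᵀ) =
      diagonal (fun i : Fin n => if (i : ℕ) < k then 0 else 1) * Uᵀ := by
    rw [firstCols_mul_transpose, Matrix.mul_sub, Matrix.mul_one, ← Matrix.mul_assoc,
      ← Matrix.mul_assoc, hU.transpose_mul_self, Matrix.one_mul]
    nth_rewrite 1 [← Matrix.one_mul Uᵀ]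
    rw [← Matrix.sub_mul, ← diagonal_one, diagonal_sub]
    congr 2
    ext i
    split_ifs <;> simp
  rw [outOfBand, ← toEuclideanLin_mul_apply, h, toEuclideanLin_mul_apply]
  simp [toEuclideanLin, Matrix.mulVec_diagonal]

theorem IsEigendecomposition.norm_transpose (hU : IsEigendecomposition W U σ)
    (z : EuclideanSpace ℝ (Fin n)) : ‖toEuclideanLin Uᵀ z‖ = ‖z‖ :=
  norm_toEuclideanLin_of_transpose_mul_self
    (by rw [Matrix.transpose_transpose, hU.mul_transpose_self]) z

theorem IsEigendecomposition.norm_conj_diagonal_sq (hU : IsEigendecomposition W U σ)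
    (d : Fin n → ℝ) (z : EuclideanSpace ℝ (Fin n)) :
    ‖toEuclideanLin (U * diagonal d * Uᵀ) z‖ ^ 2 =
      ∑ i, d i ^ 2 * toEuclideanLin Uᵀ z i ^ 2 := by
  rw [Matrix.mul_assoc, toEuclideanLin_mul_apply, toEuclideanLin_mul_apply,
    norm_toEuclideanLin_of_transpose_mul_self hU.transpose_mul_self,
    EuclideanSpace.real_norm_sq_eq]
  refine Finset.sum_congr rfl fun i _ => ?_
  rw [← mul_pow]
  congr 1
  simp [toEuclideanLin, Matrix.mulVec_diagonal]

theorem IsEigendecomposition.inner_aeval (hU : IsEigendecomposition W U σ) (g : Polynomial ℝ)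
    (z : EuclideanSpace ℝ (Fin n)) :
    inner ℝ z (toEuclideanLin (Polynomial.aeval (laplacian W) g) z) =
      ∑ i, g.eval (σ i) * toEuclideanLin Uᵀ z i ^ 2 := by
  rw [hU.aeval_eq]
  have h : z.ofLp ⬝ᵥ ((U * diagonal (fun i => g.eval (σ i)) * Uᵀ) *ᵥ z.ofLp) =
      (Uᵀ *ᵥ z.ofLp) ⬝ᵥ (diagonal (fun i => g.eval (σ i)) *ᵥ (Uᵀ *ᵥ z.ofLp)) := by
    rw [← Matrix.mulVec_mulVec, ← Matrix.mulVec_mulVec, Matrix.dotProduct_mulVec,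
      ← Matrix.mulVec_transpose]
  have h2 : inner ℝ z (toEuclideanLin (U * diagonal (fun i => g.eval (σ i)) * Uᵀ) z) =
      z.ofLp ⬝ᵥ ((U * diagonal (fun i => g.eval (σ i)) * Uᵀ) *ᵥ z.ofLp) := by
    rw [EuclideanSpace.inner_eq_star_dotProduct, dotProduct_comm]
    rfl
  rw [h2, h]
  refine Finset.sum_congr rfl fun i _ => ?_
  rw [Matrix.mulVec_diagonal]
  change _ = g.eval (σ i) * (Uᵀ *ᵥ z.ofLp) i ^ 2
  ring

theorem IsEigendecomposition.isSymmetric_aeval (hU : IsEigendecomposition W U σ)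
    (g : Polynomial ℝ) : (toEuclideanLin (Polynomial.aeval (laplacian W) g)).IsSymmetric := by
  rw [Matrix.isSymmetric_toEuclideanLin_iff, hU.aeval_eq]
  simp [Matrix.IsHermitian, Matrix.mul_assoc,
    Matrix.conjTranspose_eq_transpose_of_trivial]

end Spectral

/-! ### The space-time map and its modes. -/

section SpaceTime

variable {n : ℕ} {W U : Matrix (Fin n) (Fin n) ℝ} {σ : Fin n → ℝ} {k : ℕ}

theorem fT_sq (T : ℕ) (l : ℝ) : fT T l ^ 2 = ∑ t ∈ Finset.range T, l ^ (2 * t) :=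
  Real.sq_sqrt (Finset.sum_nonneg fun t _ => by rw [pow_mul]; positivity)

theorem fT_nonneg (T : ℕ) (l : ℝ) : 0 ≤ fT T l := Real.sqrt_nonneg _

theorem fT_pos {T : ℕ} (hT : 1 ≤ T) {l : ℝ} (hl : 0 < l) : 0 < fT T l :=
  Real.sqrt_pos.2 (Finset.sum_pos (fun t _ => by positivity) ⟨0, Finset.mem_range.2 hT⟩)

theorem fT_mono (T : ℕ) {l l' : ℝ} (hl : 0 ≤ l) (h : l ≤ l') : fT T l ≤ fT T l' :=
  Real.sqrt_le_sqrt (Finset.sum_le_sum fun _ _ => pow_le_pow_left₀ hl h _)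

theorem evolutionEigenvalue_pos (σ : Fin n → ℝ) (dt : ℝ) (i : Fin n) :
    0 < evolutionEigenvalue σ dt i := Real.exp_pos _

/-- Higher frequencies decay faster. Hence `f_T(λ_k)` is the smallest gain in the band and
`f_T(λ_{k+1})` the largest outside it. -/
theorem fT_evolutionEigenvalue_anti {dt : ℝ} (hdt : 0 < dt) (hσ : Monotone σ) (T : ℕ)
    {i j : Fin n} (hij : i ≤ j) :
    fT T (evolutionEigenvalue σ dt j) ≤ fT T (evolutionEigenvalue σ dt i) := by
  refine fT_mono T (evolutionEigenvalue_pos σ dt j).le (Real.exp_le_exp.2 ?_)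
  have := mul_le_mul_of_nonneg_left (hσ hij) hdt.le
  linarith

theorem norm_spaceTimeMap_sq (A : Matrix (Fin n) (Fin n) ℝ) (T : ℕ)
    (z : EuclideanSpace ℝ (Fin n)) :
    ‖toEuclideanLin (spaceTimeMap A T) z‖ ^ 2 =
      ∑ t ∈ Finset.range T, ‖toEuclideanLin (A ^ t) z‖ ^ 2 := by
  rw [EuclideanSpace.real_norm_sq_eq, Fintype.sum_prod_type, ← Fin.sum_univ_eq_sum_range
    (fun t => ‖toEuclideanLin (A ^ t) z‖ ^ 2)]
  refine Finset.sum_congr rfl fun t _ => ?_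
  rw [EuclideanSpace.real_norm_sq_eq]
  rfl

theorem IsEigendecomposition.norm_spaceTimeMap_evolution_sq (hU : IsEigendecomposition W U σ)
    (dt : ℝ) (T : ℕ) (z : EuclideanSpace ℝ (Fin n)) :
    ‖toEuclideanLin (spaceTimeMap (evolution W dt) T) z‖ ^ 2 =
      ∑ i, fT T (evolutionEigenvalue σ dt i) ^ 2 * toEuclideanLin Uᵀ z i ^ 2 := by
  rw [norm_spaceTimeMap_sq]
  simp_rw [hU.evolution_eq, conj_diagonal_pow hU.transpose_mul_self hU.mul_transpose_self,
    hU.norm_conj_diagonal_sq, fT_sq, Finset.sum_mul, ← pow_mul, mul_comm _ 2]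
  exact Finset.sum_comm

theorem IsEigendecomposition.norm_spaceTimeMap_outOfBand_le (hU : IsEigendecomposition W U σ)
    {dt : ℝ} (hdt : 0 < dt) (T : ℕ) (hk : k < n) (z : EuclideanSpace ℝ (Fin n)) :
    ‖toEuclideanLin (spaceTimeMap (evolution W dt) T) (outOfBand U hk z)‖ ≤
      fT T (evolutionEigenvalue σ dt ⟨k, hk⟩) * ‖outOfBand U hk z‖ := by
  refine (abs_le_of_sq_le_sq' ?_ (mul_nonneg (fT_nonneg _ _) (norm_nonneg _))).2
  rw [hU.norm_spaceTimeMap_evolution_sq, mul_pow, ← hU.norm_transpose (outOfBand U hk z),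
    EuclideanSpace.real_norm_sq_eq, Finset.mul_sum]
  refine Finset.sum_le_sum fun i _ => ?_
  rw [hU.transpose_outOfBand_apply]
  split_ifs with hi
  · simp
  · have h := fT_evolutionEigenvalue_anti hdt hU.mono T (i := ⟨k, hk⟩) (j := i) (not_lt.1 hi)
    have h0 := fT_nonneg T (evolutionEigenvalue σ dt i)
    gcongr

theorem IsEigendecomposition.spaceTimeMap_mul_firstCols (hU : IsEigendecomposition W U σ)
    (dt : ℝ) {T : ℕ} (hT : 1 ≤ T) (hk : k < n) :
    spaceTimeMap (evolution W dt) T * firstCols U hk = spaceTimeModes U σ dt hk T *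
      diagonal fun l => fT T (evolutionEigenvalue σ dt (Fin.castLE hk.le l)) := by
  ext ⟨t, i⟩ l
  have h1 : (evolution W dt ^ (t : ℕ) * U) i (Fin.castLE hk.le l) =
      U i (Fin.castLE hk.le l) * evolutionEigenvalue σ dt (Fin.castLE hk.le l) ^ (t : ℕ) := by
    rw [hU.evolution_eq, conj_diagonal_pow hU.transpose_mul_self hU.mul_transpose_self,
      Matrix.mul_assoc, hU.transpose_mul_self, Matrix.mul_one, Matrix.mul_diagonal]
  have h2 : (spaceTimeMap (evolution W dt) T * firstCols U hk) (t, i) l =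
      (evolution W dt ^ (t : ℕ) * U) i (Fin.castLE hk.le l) := rfl
  rw [h2, h1, Matrix.mul_diagonal]
  have h3 := (fT_pos hT (evolutionEigenvalue_pos σ dt (Fin.castLE hk.le l))).ne'
  simp only [spaceTimeModes, Matrix.of_apply, firstCols, Matrix.submatrix_apply, id]
  field_simp

/-- Each entry of the Gram matrix is a sum over time multiplied by a spatial inner product.
Orthogonality in space kills the off-diagonal entries, and `f_T` normalizes the diagonal ones. -/
theorem IsEigendecomposition.spaceTimeModes_transpose_mul_self (hU : IsEigendecomposition W U σ)
    (dt : ℝ) {T : ℕ} (hT : 1 ≤ T) (hk : k < n) :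
    (spaceTimeModes U σ dt hk T)ᵀ * spaceTimeModes U σ dt hk T = 1 := by
  ext l l'
  set a := evolutionEigenvalue σ dt (Fin.castLE hk.le l) with ha
  set a' := evolutionEigenvalue σ dt (Fin.castLE hk.le l') with ha'
  have h1 : ((spaceTimeModes U σ dt hk T)ᵀ * spaceTimeModes U σ dt hk T) l l' =
      (∑ t ∈ Finset.range T, a ^ t / fT T a * (a' ^ t / fT T a')) *
        ((firstCols U hk)ᵀ * firstCols U hk) l l' := by
    rw [Matrix.mul_apply, Matrix.mul_apply, Fintype.sum_prod_type, ← Fin.sum_univ_eq_sum_range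
      (fun t => a ^ t / fT T a * (a' ^ t / fT T a')), Finset.sum_mul_sum]
    refine Finset.sum_congr rfl fun t _ => Finset.sum_congr rfl fun i _ => ?_
    simp only [Matrix.transpose_apply, spaceTimeModes, Matrix.of_apply, ← ha, ← ha']
    ring
  rw [h1, hU.firstCols_transpose_mul_self]
  rcases eq_or_ne l l' with rfl | hne
  · rw [Matrix.one_apply_eq, mul_one]
    have hpos := fT_pos hT (evolutionEigenvalue_pos σ dt (Fin.castLE hk.le l))
    rw [← ha] at hpos
    have h2 : ∀ t, a ^ t / fT T a * (a ^ t / fT T a) = a ^ (2 * t) / fT T a ^ 2 := by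
      intro t
      rw [div_mul_div_comm, ← pow_add, ← two_mul, ← pow_two]
    simp only [show a' = a from rfl, h2]
    rw [← Finset.sum_div, ← fT_sq, div_self (by positivity)]
  · rw [Matrix.one_apply_ne hne, mul_zero]

end SpaceTime

/-! ### From the lower isometry bound to the reconstruction guarantee. -/

section Guarantee

variable {n : ℕ} {W U : Matrix (Fin n) (Fin n) ℝ} {σ : Fin n → ℝ} {k : ℕ}

/-- For `z = U_k d` one has `π_{A,T} z = Ũ diag(f_T(λ_l)) d`, so the isometry bound applies to the
rescaled coefficients, each scaled by at least `f_T(λ_k)`. With indices from `0`, `λ_k` sits at `k -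
1`. -/
theorem IsEigendecomposition.le_norm_spaceTimeMap_of_mem_bandlimited
    (hU : IsEigendecomposition W U σ) {dt : ℝ} (hdt : 0 < dt) (hk1 : 1 ≤ k) (hk : k < n) {T : ℕ}
    (hT : 1 ≤ T) {δ : ℝ} (hδ : δ < 1) {ι : Type*} [Fintype ι] {M : Matrix ι (Fin T × Fin n) ℝ}
    (h : ∀ w, (1 - δ) * ‖w‖ ^ 2 ≤ ‖toEuclideanLin (M * spaceTimeModes U σ dt hk T) w‖ ^ 2)
    {z : EuclideanSpace ℝ (Fin n)} (hz : z ∈ bandlimited U hk) :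
    √(1 - δ) * fT T (evolutionEigenvalue σ dt ⟨k - 1, by omega⟩) * ‖z‖ ≤
      ‖toEuclideanLin M (toEuclideanLin (spaceTimeMap (evolution W dt) T) z)‖ := by
  obtain ⟨d, rfl⟩ := (mem_bandlimited_iff U hk z).1 hz
  rw [← toEuclideanLin_mul_apply (spaceTimeMap (evolution W dt) T),
    hU.spaceTimeMap_mul_firstCols dt hT hk, toEuclideanLin_mul_apply, ← toEuclideanLin_mul_apply M,
    norm_toEuclideanLin_of_transpose_mul_self (hU.firstCols_transpose_mul_self hk)]
  set f : Fin k → ℝ := fun l => fT T (evolutionEigenvalue σ dt (Fin.castLE hk.le l)) with hf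
  refine (abs_le_of_sq_le_sq' ?_ (norm_nonneg _)).2
  refine le_trans ?_ (h (toEuclideanLin (diagonal f) d))
  rw [mul_assoc, mul_pow, Real.sq_sqrt (sub_nonneg.2 hδ.le)]
  refine mul_le_mul_of_nonneg_left ?_ (sub_nonneg.2 hδ.le)
  rw [mul_pow, EuclideanSpace.real_norm_sq_eq, EuclideanSpace.real_norm_sq_eq, Finset.mul_sum]
  refine Finset.sum_le_sum fun l _ => ?_
  have h1 : fT T (evolutionEigenvalue σ dt ⟨k - 1, by omega⟩) ≤ f l :=
    fT_evolutionEigenvalue_anti hdt hU.mono T (Fin.le_def.2 (Nat.le_sub_one_of_lt l.2))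
  have h2 : toEuclideanLin (diagonal f) d l = f l * d l := by
    simp [toEuclideanLin, Matrix.mulVec_diagonal]
  have h3 := fT_nonneg T (evolutionEigenvalue σ dt ⟨k - 1, by omega⟩)
  rw [h2, mul_pow]
  gcongr

/-- A lower restricted isometry bound on the span of the space-time modes implies the
reconstruction guarantee. -/
theorem reconstructionGuarantee_of_le (hU : IsEigendecomposition W U σ) {dt : ℝ} (hdt : 0 < dt)
    (hk1 : 1 ≤ k) (hk : k < n) {T : ℕ} (hT : 1 ≤ T) {δ : ℝ} (hδ : δ < 1)
    {ι : Type*} [Fintype ι] [DecidableEq ι]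
    {S : Matrix ι (Fin T × Fin n) ℝ} {P : Matrix (Fin T × Fin n) (Fin T × Fin n) ℝ}
    {Wt : Matrix ι ι ℝ}
    (h : ∀ w, (1 - δ) * ‖w‖ ^ 2 ≤
      ‖toEuclideanLin (reweighting S P Wt * S * spaceTimeModes U σ dt hk T) w‖ ^ 2) :
    ReconstructionGuarantee W U σ dt hk δ S P Wt := by
  unfold ReconstructionGuarantee
  intro L A R σk σk1 fk fk1 x hx e γ hγ g hg0 hgmono hg1 Mmax hM hRS
  set Φ : EuclideanSpace ℝ (Fin n) →ₗ[ℝ] EuclideanSpace ℝ ι :=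
    toEuclideanLin R ∘ₗ toEuclideanLin (S * spaceTimeMap A T) with hΦ
  set G := toEuclideanLin (Polynomial.aeval L g) with hG
  set y := toEuclideanLin (S * spaceTimeMap A T) x + e with hy
  have hδ' : 0 < √(1 - δ) := Real.sqrt_pos.2 (sub_pos.2 hδ)
  have hfk : 0 < fk := fT_pos hT (evolutionEigenvalue_pos _ _ _)
  have hΦ2 : ∀ z, Φ z = toEuclideanLin (R * S) (toEuclideanLin (spaceTimeMap A T) z) := by
    intro z
    rw [hΦ, LinearMap.comp_apply, ← toEuclideanLin_mul_apply, ← toEuclideanLin_mul_apply,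
      Matrix.mul_assoc]
  have hobj : ∀ z, objective L A S R γ g y z =
      ‖Φ z - toEuclideanLin R y‖ ^ 2 + γ * inner ℝ z (G z) := by
    intro z
    rw [objective, map_sub]
    rfl
  have hRy : toEuclideanLin R y = Φ x + toEuclideanLin R e := by rw [hy, map_add]; rfl
  have hgk : 0 ≤ g.eval σk := hg0 _ (hU.mem_spectrum _)
  have hge : ∀ i, 0 ≤ g.eval (σ i) := fun i => hg0 _ (hU.mem_spectrum _)
  have hΦa : ∀ z ∈ bandlimited U hk, √(1 - δ) * fk * ‖z‖ ≤ ‖Φ z‖ := by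
    intro z hz
    rw [hΦ2]
    exact hU.le_norm_spaceTimeMap_of_mem_bandlimited hdt hk1 hk hT hδ h hz
  have hΦb : ∀ z, ‖Φ (outOfBand U hk z)‖ ≤ Mmax * fk1 * ‖outOfBand U hk z‖ := by
    intro z
    rw [hΦ2, mul_assoc]
    exact (norm_toEuclideanLin_le_specNorm _ _).trans (mul_le_mul hRS
      (hU.norm_spaceTimeMap_outOfBand_le hdt T hk z) (norm_nonneg _) hM.le)
  have hGb : ∀ z, g.eval σk1 * ‖outOfBand U hk z‖ ^ 2 ≤ inner ℝ z (G z) := by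
    intro z
    rw [hG, hU.inner_aeval, ← hU.norm_transpose, EuclideanSpace.real_norm_sq_eq, Finset.mul_sum]
    refine Finset.sum_le_sum fun i _ => ?_
    rw [hU.transpose_outOfBand_apply]
    split_ifs with hi
    · rw [zero_pow two_ne_zero, mul_zero]
      exact mul_nonneg (hge i) (sq_nonneg _)
    · exact mul_le_mul_of_nonneg_right (hgmono (hU.mem_spectrum _) (hU.mem_spectrum _)
        (hU.mono (not_lt.1 hi))) (sq_nonneg _)
  have hGx : inner ℝ x (G x) ≤ g.eval σk * ‖x‖ ^ 2 := by
    rw [hG, hU.inner_aeval, ← hU.norm_transpose x, EuclideanSpace.real_norm_sq_eq, Finset.mul_sum]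
    refine Finset.sum_le_sum fun i _ => ?_
    by_cases hi : (i : ℕ) < k
    · exact mul_le_mul_of_nonneg_right (hgmono (hU.mem_spectrum _) (hU.mem_spectrum _)
        (hU.mono (by rw [Fin.le_def]; simp only; omega))) (sq_nonneg _)
    · have h1 := hU.transpose_outOfBand_apply hk x i
      rw [hU.outOfBand_eq_zero hk hx, if_neg hi, map_zero, PiLp.zero_apply] at h1
      rw [← h1]
      simp
  have hpos : ∀ z, z ≠ 0 → 0 < ‖Φ z‖ ^ 2 + γ * inner ℝ z (G z) := by
    intro z hz
    -- In-band vectors are detected by the data term, all others by the regularizer; neither form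
    -- need be definite alone.
    by_cases hb : outOfBand U hk z = 0
    · have hzK : z ∈ bandlimited U hk := by
        have h1 := inBand_mem_bandlimited U hk z
        have h2 := inBand_add_outOfBand U hk z
        rw [hb, add_zero] at h2
        rwa [h2] at h1
      have h1 : 0 < ‖Φ z‖ :=
        lt_of_lt_of_le (mul_pos (mul_pos hδ' hfk) (norm_pos_iff.2 hz)) (hΦa z hzK)
      have h2 := hGb z
      rw [hb, norm_zero] at h2
      have h3 : 0 ≤ inner ℝ z (G z) := by simpa using h2
      positivity
    · have h1 : 0 < g.eval σk1 * ‖outOfBand U hk z‖ ^ 2 :=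
        mul_pos hg1 (pow_pos (norm_pos_iff.2 hb) 2)
      have h2 := mul_pos hγ (h1.trans_le (hGb z))
      positivity
  refine ⟨?_, fun xs hxs => ?_⟩
  · have hex := existsUnique_isMin_regularized (hU.isSymmetric_aeval g) hpos (toEuclideanLin R y)
    simpa only [IsSolution, hobj] using hex
  · have h1 := hxs x
    rw [hobj, hobj, hRy] at h1
    obtain ⟨ha, hb⟩ := regularized_error_bounds hγ (inBand_mem_bandlimited U hk)
      (inBand_add_outOfBand U hk) (mul_pos hδ' hfk) (mul_nonneg hM.le (fT_nonneg _ _)) hg1 hΦa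
      hΦb hGb hx hGx hgk (toEuclideanLin R e) h1
    refine ⟨ha, hb, fun hg he => ?_⟩
    -- Every term of both bounds now carries a zero factor, so `α* = x` and `β* = 0`.
    rw [hg, he] at ha hb
    simp only [map_zero, norm_zero, mul_zero, zero_div, Real.sqrt_zero, zero_mul, add_zero,
      norm_le_zero_iff] at ha hb
    rw [← inBand_add_outOfBand U hk xs, hb, sub_eq_zero.1 ha, add_zero]

end Guarantee

end GraphSampling

namespace GraphSampling

/-! ### Reweighted sampling and coherence. -/

section Sampling

theorem samplingMatrix_mul {ι κ τ : Type*} [Fintype κ] [DecidableEq κ] (loc : ι → κ)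
    (M : Matrix κ τ ℝ) : samplingMatrix loc * M = M.submatrix loc id := by
  ext r c
  simp [samplingMatrix, Matrix.mul_apply]

/-- Repeated draws make `S P Sᵀ` non-diagonal, but its diagonal part has entries `p (loc r)`. So row
`r` simply receives the importance weight `w r / p (loc r)`. -/
theorem norm_reweighting_mul_sampling_sq {ι κ τ : Type*} [Fintype ι] [Fintype κ] [Fintype τ]
    [DecidableEq ι] [DecidableEq κ] [DecidableEq τ] (loc : ι → κ) {p : κ → ℝ} {w : ι → ℝ}
    (hp : ∀ c, 0 ≤ p c) (hw : ∀ r, 0 ≤ w r) (V : Matrix κ τ ℝ) (z : EuclideanSpace ℝ τ) :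
    ‖toEuclideanLin (reweighting (samplingMatrix loc) (diagonal p) (diagonal w) *
        samplingMatrix loc * V) z‖ ^ 2 =
      ∑ r, w r / p (loc r) * toEuclideanLin V z (loc r) ^ 2 := by
  have hP : sampledProb (samplingMatrix loc) (diagonal p) = diagonal fun r => p (loc r) := by
    rw [sampledProb]
    congr 1
    ext r
    rw [Matrix.diag_apply, Matrix.mul_assoc, samplingMatrix_mul]
    simp [samplingMatrix]
  have hR : reweighting (samplingMatrix loc) (diagonal p) (diagonal w) =
      diagonal fun r => p (loc r) ^ (-(1 / 2) : ℝ) * w r ^ (1 / 2 : ℝ) := by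
    rw [reweighting, hP, diagPow, diagPow, diagonal_mul_diagonal]
    simp
  rw [hR, Matrix.mul_assoc, samplingMatrix_mul, EuclideanSpace.real_norm_sq_eq]
  refine Finset.sum_congr rfl fun r _ => ?_
  have h1 : toEuclideanLin ((diagonal fun r => p (loc r) ^ (-(1 / 2) : ℝ) * w r ^ (1 / 2 : ℝ)) *
      V.submatrix loc id) z r =
      p (loc r) ^ (-(1 / 2) : ℝ) * w r ^ (1 / 2 : ℝ) * toEuclideanLin V z (loc r) := by
    rw [toEuclideanLin_mul_apply]
    change (diagonal _ *ᵥ (V.submatrix loc id *ᵥ z.ofLp)) r = _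
    rw [Matrix.mulVec_diagonal]
    rfl
  rw [h1, mul_pow, mul_pow, ← Real.sqrt_eq_rpow, Real.sq_sqrt (hw r), Real.rpow_neg (hp _),
    ← Real.sqrt_eq_rpow, inv_pow, Real.sq_sqrt (hp _)]
  ring

/-- With high probability, a sampled and reweighted sum of squares is bounded below by `1 - δ`
times its mean. -/
theorem one_sub_le_measureReal_forall_le {E F ι κ Ω : Type*}
    [NormedAddCommGroup E] [InnerProductSpace ℝ E] [FiniteDimensional ℝ E]
    [NormedAddCommGroup F] [InnerProductSpace ℝ F] [CompleteSpace F] [Fintype ι] [Fintype κ]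
    [MeasurableSpace κ] [MeasurableSingletonClass κ] [MeasurableSpace Ω] {μ : Measure Ω}
    [IsProbabilityMeasure μ] {q : ι → κ → ℝ} {ω : ι → Ω → κ} (hω : IsIndependentDraw μ q ω)
    (hq : ∀ j, IsNondegenerate (q j)) (C : ι → κ → E →L[ℝ] F) (N : ι → ℕ) {ε δ : ℝ}
    (hε : 0 < ε) (hε1 : ε < 1) (hδ : 0 < δ) (hE : 1 ≤ Module.finrank ℝ E)
    (hC : ∀ j c, 3 / δ ^ 2 * (1 / √(q j c) * ‖C j c‖) ^ 2 *
      Real.log (2 * Module.finrank ℝ E / ε) ≤ N j)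
    (hsum : ∀ w, ∑ j, 1 / (N j : ℝ) * ∑ c, ‖C j c w‖ ^ 2 = ‖w‖ ^ 2) :
    1 - ε ≤ μ.real {s | ∀ w, (1 - δ) * ‖w‖ ^ 2 ≤
      ∑ j, 1 / (N j : ℝ) / q j (ω j s) * ‖C j (ω j s) w‖ ^ 2} := by
  obtain ⟨k, hk⟩ : ∃ k : ℝ, (Module.finrank ℝ E : ℝ) = k := ⟨_, rfl⟩
  rw [hk] at hC
  have hk1 : 1 ≤ k := by
    rw [← hk]
    exact_mod_cast hE
  set ℓ := Real.log (2 * k / ε) with hℓ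
  have hquot : 1 < 2 * k / ε := by
    rw [lt_div_iff₀ hε]
    linarith
  have hℓ0 : 0 < ℓ := Real.log_pos hquot
  -- The largest `b` that the sample size hypothesis guarantees as a bound for `‖B j c‖²`; it turns
  -- the Chernoff exponent into `3ℓ/2`.
  set b := δ ^ 2 / (3 * ℓ) with hb
  have hb0 : 0 < b := by positivity
  let B : ι → κ → E →L[ℝ] F := fun j c => √(1 / (N j : ℝ) / q j c) • C j c
  have hq0 : ∀ j c, 0 < q j c := fun j c => (hq j).pos c
  have hBsq : ∀ j c w, ‖B j c w‖ ^ 2 = 1 / (N j : ℝ) / q j c * ‖C j c w‖ ^ 2 := by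
    intro j c w
    have := (hq0 j c).le
    simp only [B, _root_.smul_apply, norm_smul, mul_pow, Real.norm_eq_abs, sq_abs]
    rw [Real.sq_sqrt (by positivity)]
  have hB : ∀ j c, ‖B j c‖ ^ 2 ≤ b := by
    intro j c
    have h0 := (hq0 j c).le
    have h1 : ‖B j c‖ ^ 2 = (1 / √(q j c) * ‖C j c‖) ^ 2 / N j := by
      simp only [B, norm_smul, mul_pow, Real.norm_eq_abs, sq_abs, div_pow, one_pow]
      rw [Real.sq_sqrt (by positivity), Real.sq_sqrt h0]
      ring
    rw [h1]
    -- Also valid for `N j = 0`, where the quotient is `0`.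
    refine div_le_of_le_mul₀ (Nat.cast_nonneg _) hb0.le ?_
    refine le_trans (le_of_eq ?_) (mul_le_mul_of_nonneg_left (hC j c) hb0.le)
    rw [hb]
    field_simp
  have hBsum : ∀ w, ∑ j, ∑ c, q j c * ‖B j c w‖ ^ 2 = ‖w‖ ^ 2 := by
    intro w
    rw [← hsum w]
    refine Finset.sum_congr rfl fun j _ => ?_
    rw [Finset.mul_sum]
    refine Finset.sum_congr rfl fun c _ => ?_
    rw [hBsq]
    have := (hq0 j c).ne'
    field_simp
  have hbad := measureReal_sum_norm_sq_lt_le hω (fun j c => (hq0 j c).le)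
    (fun j => (hq j).sum_one) B hb0 hB hBsum hδ
  simp only [hBsq, hk] at hbad
  have hexp : k * Real.exp (-(δ ^ 2 / (2 * b))) ≤ ε := by
    have h1 : δ ^ 2 / (2 * b) = 3 / 2 * ℓ := by
      rw [hb]
      field_simp
    -- The slack in the constant `3` is discarded; what remains still gives failure probability at
    -- most `ε/2`.
    have h2 : Real.exp (-(3 / 2 * ℓ)) ≤ Real.exp (-ℓ) := Real.exp_le_exp.2 (by linarith)
    rw [Real.exp_neg ℓ, hℓ, Real.exp_log (by linarith), inv_div] at h2
    rw [h1]
    calc k * Real.exp (-(3 / 2 * ℓ)) ≤ k * (ε / (2 * k)) :=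
          mul_le_mul_of_nonneg_left h2 (by linarith)
      _ = ε / 2 := by field_simp
      _ ≤ ε := by linarith
  set A := {s | ∃ w, ∑ j, 1 / (N j : ℝ) / q j (ω j s) * ‖C j (ω j s) w‖ ^ 2 <
    (1 - δ) * ‖w‖ ^ 2} with hA
  have hAc : Aᶜ = {s | ∀ w, (1 - δ) * ‖w‖ ^ 2 ≤
      ∑ j, 1 / (N j : ℝ) / q j (ω j s) * ‖C j (ω j s) w‖ ^ 2} := by
    ext s
    simp [hA]
  -- Subadditivity suffices, so measurability of `A` plays no role.
  have h1 := measureReal_union_le (μ := μ) A Aᶜ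
  rw [Set.union_compl_self, probReal_univ] at h1
  rw [← hAc]
  linarith [hbad.trans hexp]

/-- Covers an empty sample: if the required sample size is `0`, the operator vanishes, so the
convention `1/0 = 0` does not spoil the mean identity. -/
theorem eq_zero_of_coherence_le_zero {E F : Type*} [NormedAddCommGroup E] [NormedSpace ℝ E]
    [NormedAddCommGroup F] [NormedSpace ℝ F] {C : E →L[ℝ] F} {q δ ℓ : ℝ} (hq : 0 < q)
    (hδ : 0 < δ) (hℓ : 0 < ℓ) (h : 3 / δ ^ 2 * (1 / √q * ‖C‖) ^ 2 * ℓ ≤ 0) : C = 0 := by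
  by_contra hne
  have h1 := norm_pos_iff.2 hne
  have h2 := Real.sqrt_pos.2 hq
  have : 0 < 3 / δ ^ 2 * (1 / √q * ‖C‖) ^ 2 * ℓ := by positivity
  linarith

theorem natCast_mul_one_div_mul_cancel {m : ℕ} {a : ℝ} (h : m = 0 → a = 0) :
    (m : ℝ) * (1 / (m : ℝ) * a) = a := by
  rcases eq_or_ne m 0 with h0 | h0
  · simp [h h0]
  · field_simp

theorem coherence_mul_le {a ν δ ℓ x : ℝ} (ha : 0 ≤ a) (haν : a ≤ ν) (hℓ : 0 ≤ ℓ)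
    (h : 3 / δ ^ 2 * ν ^ 2 * ℓ ≤ x) : 3 / δ ^ 2 * a ^ 2 * ℓ ≤ x :=
  le_trans (by gcongr) h

theorem log_two_mul_div_pos {k : ℕ} (hk : 1 ≤ k) {ε : ℝ} (hε : 0 < ε) (hε1 : ε < 1) :
    0 < Real.log (2 * k / ε) := by
  have hk1 : (1 : ℝ) ≤ k := by exact_mod_cast hk
  refine Real.log_pos ?_
  rw [lt_div_iff₀ hε]
  linarith

variable {n T k : ℕ}

/-- The functional `w ↦ (V w)_r`. -/
noncomputable def rowFunctional (V : Matrix (Fin T × Fin n) (Fin k) ℝ) (r : Fin T × Fin n) :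
    EuclideanSpace ℝ (Fin k) →L[ℝ] ℝ :=
  innerSL ℝ (toEuclideanLin Vᵀ (EuclideanSpace.single r (1 : ℝ)))

theorem norm_rowFunctional (V : Matrix (Fin T × Fin n) (Fin k) ℝ) (r : Fin T × Fin n) :
    ‖rowFunctional V r‖ = ‖toEuclideanLin Vᵀ (EuclideanSpace.single r (1 : ℝ))‖ :=
  innerSL_apply_norm _ _

theorem norm_rowFunctional_apply_sq (V : Matrix (Fin T × Fin n) (Fin k) ℝ) (r : Fin T × Fin n)
    (w : EuclideanSpace ℝ (Fin k)) : ‖rowFunctional V r w‖ ^ 2 = toEuclideanLin V w r ^ 2 := by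
  have h : rowFunctional V r w = toEuclideanLin V w r := by
    rw [rowFunctional, innerSL_apply_apply, EuclideanSpace.inner_eq_star_dotProduct]
    simp [toEuclideanLin, mulVec, dotProduct, mul_comm]
  rw [h, Real.norm_eq_abs, sq_abs]

/-- The `T × k` block of rows of `V` that belong to the vertex `i`, as an operator. -/
noncomputable def vertexBlock (V : Matrix (Fin T × Fin n) (Fin k) ℝ) (i : Fin n) :
    EuclideanSpace ℝ (Fin k) →L[ℝ] EuclideanSpace ℝ (Fin T) :=
  LinearMap.toContinuousLinearMap (toEuclideanLin (V.submatrix (fun t : Fin T => (t, i)) id))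

theorem norm_vertexBlock_apply_sq (V : Matrix (Fin T × Fin n) (Fin k) ℝ) (i : Fin n)
    (w : EuclideanSpace ℝ (Fin k)) :
    ‖vertexBlock V i w‖ ^ 2 = ∑ t, toEuclideanLin V w (t, i) ^ 2 := by
  rw [EuclideanSpace.real_norm_sq_eq]
  rfl

theorem norm_vertexBlock_le_coherence1 (V : Matrix (Fin T × Fin n) (Fin k) ℝ) (p : Fin n → ℝ)
    (i : Fin n) : 1 / √(p i) * ‖vertexBlock V i‖ ≤ coherence1 V p :=
  le_ciSup (f := fun i : Fin n =>
    1 / √(p i) * specNorm (V.submatrix (fun t : Fin T => (t, i)) id))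
    (Set.finite_range _).bddAbove i

theorem norm_rowFunctional_le_coherence2 (V : Matrix (Fin T × Fin n) (Fin k) ℝ)
    (p : Fin T → Fin n → ℝ) (t : Fin T) (i : Fin n) :
    1 / √(p t i) * ‖rowFunctional V (t, i)‖ ≤ coherence2 V p t := by
  rw [norm_rowFunctional]
  exact le_ciSup (f := fun i : Fin n => 1 / √(p t i) *
    ‖toEuclideanLin Vᵀ (EuclideanSpace.single (t, i) (1 : ℝ))‖) (Set.finite_range _).bddAbove i

theorem norm_rowFunctional_le_coherence3 (V : Matrix (Fin T × Fin n) (Fin k) ℝ)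
    (p : Fin T × Fin n → ℝ) (r : Fin T × Fin n) :
    1 / √(p r) * ‖rowFunctional V r‖ ≤ coherence3 V p := by
  rw [norm_rowFunctional]
  exact le_ciSup (f := fun r : Fin T × Fin n => 1 / √(p r) *
    ‖toEuclideanLin Vᵀ (EuclideanSpace.single r (1 : ℝ))‖) (Set.finite_range _).bddAbove r

end Sampling

/-! ### The three sampling regimes. -/

section Regimes

variable {n : ℕ} {W U : Matrix (Fin n) (Fin n) ℝ} {σ : Fin n → ℝ} {k T : ℕ}
  {Ω : Type*} [MeasurableSpace Ω] {μ : Measure Ω} [IsProbabilityMeasure μ]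

theorem IsEigendecomposition.sum_spaceTimeModes_sq (hU : IsEigendecomposition W U σ) (dt : ℝ)
    (hT : 1 ≤ T) (hk : k < n) (w : EuclideanSpace ℝ (Fin k)) :
    ∑ r, toEuclideanLin (spaceTimeModes U σ dt hk T) w r ^ 2 = ‖w‖ ^ 2 := by
  rw [← EuclideanSpace.real_norm_sq_eq, norm_toEuclideanLin_of_transpose_mul_self
    (hU.spaceTimeModes_transpose_mul_self dt hT hk)]

/-- One draw reveals a whole time series, so a summand is the operator `vertexBlock` into `ℝ^T` and
the coherence is a spectral norm. -/
theorem reconstructionGuarantee_of_vertex_draws (hU : IsEigendecomposition W U σ) {dt : ℝ}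
    (hdt : 0 < dt) (hk1 : 1 ≤ k) (hk : k < n) (hT : 1 ≤ T) {ε δ : ℝ}
    (hε : ε ∈ Set.Ioo (0 : ℝ) 1) (hδ : δ ∈ Set.Ioo (0 : ℝ) 1) {p : Fin n → ℝ} {m : ℕ}
    {ω : Fin m → Ω → Fin n} (hp : IsNondegenerate p) (hω : IsIndependentDraw μ (fun _ => p) ω)
    (hm : 3 / δ ^ 2 * coherence1 (spaceTimeModes U σ dt hk T) p ^ 2 * Real.log (2 * k / ε) ≤ m) :
    1 - ε ≤ μ.real {s | ReconstructionGuarantee W U σ dt hk δ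
      (S1 T fun j => ω j s) (P1 T p) (W1 T m)} := by
  set V := spaceTimeModes U σ dt hk T with hV
  have hℓ := log_two_mul_div_pos hk1 hε.1 hε.2
  have hC : ∀ c, 3 / δ ^ 2 * (1 / √(p c) * ‖vertexBlock V c‖) ^ 2 * Real.log (2 * k / ε) ≤ m :=
    fun c => coherence_mul_le (by positivity) (norm_vertexBlock_le_coherence1 V p c) hℓ.le hm
  have hprob := one_sub_le_measureReal_forall_le hω (fun _ => hp) (fun _ c => vertexBlock V c)
    (fun _ => m) hε.1 hε.2 hδ.1 (by simpa using hk1) (by simpa using fun _ => hC) (by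
      intro w
      rw [Finset.sum_const, Finset.card_univ, Fintype.card_fin, nsmul_eq_mul,
        natCast_mul_one_div_mul_cancel]
      · simp_rw [norm_vertexBlock_apply_sq]
        rw [Finset.sum_comm, ← Fintype.sum_prod_type', hU.sum_spaceTimeModes_sq dt hT hk]
      · rintro rfl
        refine Finset.sum_eq_zero fun c _ => ?_
        rw [eq_zero_of_coherence_le_zero (hp.pos c) hδ.1 hℓ ((hC c).trans_eq Nat.cast_zero)]
        simp)
  refine hprob.trans (measureReal_mono fun s hs => ?_)
  refine reconstructionGuarantee_of_le hU hdt hk1 hk hT hδ.2 fun w => (hs w).trans_eq ?_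
  have hW : W1 T m = diagonal fun _ => 1 / (m : ℝ) := by rw [W1, smul_one_eq_diagonal]
  -- Swapping the sums over times and draws regroups the sampled rows by draw.
  rw [hW, S1, P1, norm_reweighting_mul_sampling_sq _ (p := fun r : Fin T × Fin n => p r.2) (fun r => (hp.pos r.2).le)
    (fun _ => by positivity), Fintype.sum_prod_type, Finset.sum_comm]
  refine Finset.sum_congr rfl fun j _ => ?_
  rw [norm_vertexBlock_apply_sq, Finset.mul_sum]

/-- The draws are independent but not identically distributed. The `m t` weights `1 / m t` normalize
each time block separately, and only the sum over all blocks has mean identity. -/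
theorem reconstructionGuarantee_of_vertex_draws_at_each_time (hU : IsEigendecomposition W U σ)
    {dt : ℝ} (hdt : 0 < dt) (hk1 : 1 ≤ k) (hk : k < n) (hT : 1 ≤ T) {ε δ : ℝ}
    (hε : ε ∈ Set.Ioo (0 : ℝ) 1) (hδ : δ ∈ Set.Ioo (0 : ℝ) 1) {p : Fin T → Fin n → ℝ}
    {m : Fin T → ℕ} {ω : (t : Fin T) × Fin (m t) → Ω → Fin n} (hp : ∀ t, IsNondegenerate (p t))
    (hω : IsIndependentDraw μ (fun r => p r.1) ω)
    (hm : ∀ t, 3 / δ ^ 2 * coherence2 (spaceTimeModes U σ dt hk T) p t ^ 2 *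
      Real.log (2 * k / ε) ≤ m t) :
    1 - ε ≤ μ.real {s | ReconstructionGuarantee W U σ dt hk δ
      (S2 fun r => ω r s) (P2 p) (W2 m)} := by
  set V := spaceTimeModes U σ dt hk T with hV
  have hℓ := log_two_mul_div_pos hk1 hε.1 hε.2
  have hC : ∀ t c, 3 / δ ^ 2 * (1 / √(p t c) * ‖rowFunctional V (t, c)‖) ^ 2 *
      Real.log (2 * k / ε) ≤ m t := fun t c =>
    coherence_mul_le (by positivity) (norm_rowFunctional_le_coherence2 V p t c) hℓ.le (hm t)
  have hprob := one_sub_le_measureReal_forall_le hω (fun r => hp r.1)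
    (fun r c => rowFunctional V (r.1, c)) (fun r => m r.1) hε.1 hε.2 hδ.1 (by simpa using hk1)
    (fun r c => by simpa using hC r.1 c) (by
      intro w
      rw [← hU.sum_spaceTimeModes_sq dt hT hk w, Fintype.sum_sigma, Fintype.sum_prod_type]
      refine Finset.sum_congr rfl fun t _ => ?_
      change ∑ _ : Fin (m t), 1 / (m t : ℝ) * ∑ c, ‖rowFunctional V (t, c) w‖ ^ 2 = _
      rw [Finset.sum_const, Finset.card_univ, Fintype.card_fin, nsmul_eq_mul,
        natCast_mul_one_div_mul_cancel]
      · simp_rw [norm_rowFunctional_apply_sq, hV]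
      · intro h0
        refine Finset.sum_eq_zero fun c _ => ?_
        rw [eq_zero_of_coherence_le_zero ((hp t).pos c) hδ.1 hℓ
          ((hC t c).trans_eq (by rw [h0, Nat.cast_zero]))]
        simp)
  refine hprob.trans (measureReal_mono fun s hs => ?_)
  refine reconstructionGuarantee_of_le hU hdt hk1 hk hT hδ.2 fun w => (hs w).trans_eq ?_
  rw [W2, S2, P2, norm_reweighting_mul_sampling_sq _ (p := fun r : Fin T × Fin n => p r.1 r.2)
    (fun r => ((hp r.1).pos r.2).le)
    (fun _ => by positivity)]
  exact Finset.sum_congr rfl fun r _ => by rw [norm_rowFunctional_apply_sq]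

/-- Each draw contributes a single row of `Ũ`, hence a rank-one term whose size is the row norm
appearing in the coherence. -/
theorem reconstructionGuarantee_of_space_time_draws (hU : IsEigendecomposition W U σ) {dt : ℝ}
    (hdt : 0 < dt) (hk1 : 1 ≤ k) (hk : k < n) (hT : 1 ≤ T) {ε δ : ℝ}
    (hε : ε ∈ Set.Ioo (0 : ℝ) 1) (hδ : δ ∈ Set.Ioo (0 : ℝ) 1) {p : Fin T × Fin n → ℝ} {m : ℕ}
    {ω : Fin m → Ω → Fin T × Fin n} (hp : IsNondegenerate p)
    (hω : IsIndependentDraw μ (fun _ => p) ω)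
    (hm : 3 / δ ^ 2 * coherence3 (spaceTimeModes U σ dt hk T) p ^ 2 * Real.log (2 * k / ε) ≤ m) :
    1 - ε ≤ μ.real {s | ReconstructionGuarantee W U σ dt hk δ
      (S3 fun j => ω j s) (P3 p) (W3 m)} := by
  set V := spaceTimeModes U σ dt hk T with hV
  have hℓ := log_two_mul_div_pos hk1 hε.1 hε.2
  have hC : ∀ c, 3 / δ ^ 2 * (1 / √(p c) * ‖rowFunctional V c‖) ^ 2 * Real.log (2 * k / ε) ≤ m :=
    fun c => coherence_mul_le (by positivity) (norm_rowFunctional_le_coherence3 V p c) hℓ.le hm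
  have hprob := one_sub_le_measureReal_forall_le hω (fun _ => hp) (fun _ c => rowFunctional V c)
    (fun _ => m) hε.1 hε.2 hδ.1 (by simpa using hk1) (fun _ c => by simpa using hC c) (by
      intro w
      rw [Finset.sum_const, Finset.card_univ, Fintype.card_fin, nsmul_eq_mul,
        natCast_mul_one_div_mul_cancel]
      · simp_rw [norm_rowFunctional_apply_sq]
        exact hU.sum_spaceTimeModes_sq dt hT hk w
      · rintro rfl
        refine Finset.sum_eq_zero fun c _ => ?_
        rw [eq_zero_of_coherence_le_zero (hp.pos c) hδ.1 hℓ ((hC c).trans_eq Nat.cast_zero)]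
        simp)
  refine hprob.trans (measureReal_mono fun s hs => ?_)
  refine reconstructionGuarantee_of_le hU hdt hk1 hk hT hδ.2 fun w => (hs w).trans_eq ?_
  have hW : W3 m = diagonal fun _ => 1 / (m : ℝ) := by rw [W3, smul_one_eq_diagonal]
  rw [hW, S3, P3, norm_reweighting_mul_sampling_sq _ (fun r => (hp.pos r).le)
    (fun _ => by positivity)]
  exact Finset.sum_congr rfl fun j _ => by rw [norm_rowFunctional_apply_sq]

end Regimes

end GraphSampling

theorem mainTheorem3
    {n : ℕ} (Wadj : Matrix (Fin n) (Fin n) ℝ) (hW : IsWeightMatrix Wadj)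
    (U : Matrix (Fin n) (Fin n) ℝ) (σ : Fin n → ℝ) (hU : IsEigendecomposition Wadj U σ)
    (dt : ℝ) (hdt : 0 < dt)
    (k : ℕ) (hk1 : 1 ≤ k) (hk : k < n)
    (T : ℕ) (hT : 1 ≤ T)
    (ε δ : ℝ) (hε : ε ∈ Set.Ioo (0 : ℝ) 1) (hδ : δ ∈ Set.Ioo (0 : ℝ) 1)
    {Ω : Type*} [MeasurableSpace Ω] (μ : Measure Ω) [IsProbabilityMeasure μ] :
    (∀ (p : Fin n → ℝ) (m : ℕ) (ω : Fin m → Ω → Fin n),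
      IsNondegenerate p → IsIndependentDraw μ (fun _ => p) ω →
      3 / δ ^ 2 * coherence1 (spaceTimeModes U σ dt hk T) p ^ 2 * Real.log (2 * k / ε) ≤ m →
      1 - ε ≤ μ.real {s | ReconstructionGuarantee Wadj U σ dt hk δ
        (S1 T fun j => ω j s) (P1 T p) (W1 T m)}) ∧
    (∀ (p : Fin T → Fin n → ℝ) (m : Fin T → ℕ) (ω : (t : Fin T) × Fin (m t) → Ω → Fin n),
      (∀ t, IsNondegenerate (p t)) → IsIndependentDraw μ (fun r => p r.1) ω →
      (∀ t, 3 / δ ^ 2 * coherence2 (spaceTimeModes U σ dt hk T) p t ^ 2 * Real.log (2 * k / ε)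
        ≤ m t) →
      1 - ε ≤ μ.real {s | ReconstructionGuarantee Wadj U σ dt hk δ
        (S2 fun r => ω r s) (P2 p) (W2 m)}) ∧
    (∀ (p : Fin T × Fin n → ℝ) (m : ℕ) (ω : Fin m → Ω → Fin T × Fin n),
      IsNondegenerate p → IsIndependentDraw μ (fun _ => p) ω →
      3 / δ ^ 2 * coherence3 (spaceTimeModes U σ dt hk T) p ^ 2 * Real.log (2 * k / ε) ≤ m →
      1 - ε ≤ μ.real {s | ReconstructionGuarantee Wadj U σ dt hk δ
        (S3 fun j => ω j s) (P3 p) (W3 m)}) := by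
  exact ⟨fun p m ω hp hω hm =>
      reconstructionGuarantee_of_vertex_draws hU hdt hk1 hk hT hε hδ hp hω hm,
    fun p m ω hp hω hm =>
      reconstructionGuarantee_of_vertex_draws_at_each_time hU hdt hk1 hk hT hε hδ hp hω hm,
    fun p m ω hp hω hm =>
      reconstructionGuarantee_of_space_time_draws hU hdt hk1 hk hT hε hδ hp hω hm⟩
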